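/- Let $b\ge 2$ and $r\ge 2$ be integers, let $\mathbb K$ be a field of characteristic $0$ and $\mathbb L$ an algebraic field extension of $\mathbb K$. Let $M$ be the operator substituting $x^b$ for $x$ (or $t^b$ for $t$; it fixes constants). Let $\ell_0,\dots,\ell_r\in\mathbb K[x]$ have gcd $1$, with $\ell_0\ell_r\ne 0$. Consider the linear Mahler equation $$(\mathrm L)\qquad \ell_r M^r y+\dots+\ell_1 My+\ell_0 y=0$$ and the Riccati Mahler equation $$(\mathrm R)\qquad \ell_r\,u\,Mu\cdots M^{r-1}u+\dots+\ell_2\,u\,Mu+\ell_1u+\ell_0=0 .$$ **Algorithm BP.** Start with $\mathscr U=\varnothing$. For all monic $A,B\in\mathbb L[t]$ such that $A\mid\ell_0(t)$, $B\mid\ell_r(t)$ and $M^iA$, $B$ are coprime for $0\le i<r$, form $$\tilde L(t,M)=\sum_{k=0}^r\Bigl(\ell_k(t^{b^{r-1}})\prod_{j=0}^{k-1}M^{r-1+j}A\prod_{j=k}^{r-1}M^jB\Bigr)M^k=\sum_{k,j}\tilde\ell_{k,j}\,t^jM^k .$$ The upper Newton polygon of $\tilde L$ is the upper convex hull of the points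 $(b^k,j)$ with $\tilde\ell_{k,j}\ne0$; the characteristic polynomial of an edge whose end points have abscissae $b^{k_1}<b^{k_2}$ is the sum of $\tilde\ell_{k,j}X^{k-k_1}$ over the points $(b^k,j)$ on that edge; the edge is $\zeta$-admissible if $\zeta$ is a root of it. For each $\zeta\in\mathbb L$ for which there is a $\zeta$-admissible edge, let $\Delta_\zeta$ be the maximum of the integers among the opposites of the slopes of the $\zeta$-admissible edges. If $\Delta_\zeta$ exists and $\Delta_\zeta\ge0$, compute a basis $(C_1,\dots,C_s)$ of the $\mathbb L$-space of the solutions $C\in\mathbb L[t]$ of degree at most $\Delta_\zeta$ of $\tilde L(t,\zeta M)\,C=0$. If $s>0$, set $C=\sum_{i=1}^s c_iC_i$ for formal parameters $c_i$, find $u(x)\in\mathbb L(c_1,\dots,c_s)(x)$ such that $$u(t^{b^{r-1}})=\zeta\,\frac{C(t^b)}{C(t)}\,\frac{A(t^{b^{r-1}})}{B(t)},$$ and add $u$ to $\mathscr U$. Finally, while $\mathscr U$ contains two distinct elements $u^{(1)}$ and $u^{(2)}$ such that the set of rational functions parametrized by $u^{(1)}$ (letting the parameters range over the nonzero vectors over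 $\mathbb L$) is included in the one parametrized by $u^{(2)}$, remove $u^{(1)}$ from $\mathscr U$. Return $\mathscr U$. **Blocks.** Let $\mathfrak D_{\mathbb L}=\bigoplus_{\lambda\in\mathbb L\setminus\{0\}}e_\lambda P$, where $P=\bigcup_{q\ge1}\mathbb L((x^{1/q}))$ is the field of Puiseux series, $e_\lambda e_{\lambda'}=e_{\lambda\lambda'}$, $e_1=1$, and $M$ is extended by $Me_\lambda=\lambda e_\lambda$. A hypergeometric solution is a solution $y\in\mathfrak D_{\mathbb L}$ of $(\mathrm L)$ such that $My=uy$ for some $u\in\mathbb L(x)$ (unique if $y\ne0$, and then denoted $My/y$). Two nonzero hypergeometric solutions $y_1,y_2$ are similar if $y_1=qy_2$ for some nonzero $q\in\mathbb L(x)$. A block is the image under $y\mapsto My/y$ of a similarity class of nonzero hypergeometric solutions. **Theorem.** Algorithm BP executes without failure (in particular each required $u(x)$ exists and is unique) and terminates, whatever bases and whatever elements to remove are chosen. Each possible output $\mathscr U$ is finite, and: 1. each $u\in\mathscr U$, with its $s\geq 1$ parameters, can be evaluated at every point of the projective space $\mathbb P^{s-1}(\mathbb L)$, and evaluation is a bijection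 from $\mathbb P^{s-1}(\mathbb L)$ onto the set of rational functions parametrized by $u$; 2. the set of all solutions $u\in\mathbb L(x)$ of $(\mathrm R)$ is the disjoint union of the sets parametrized by the elements of $\mathscr U$; 3. the sets parametrized by the elements of $\mathscr U$ are blocks, and each block is parametrized by exactly one element of $\mathscr U$. -/

import Mathlib

noncomputable section

namespace MahlerBP

open Polynomial

/-! ### Mahler operators on polynomials and rational functions -/

/-- The data of a linear Mahler operator `L = ∑ k ≤ r, ℓ k * M ^ k` of order `r ≥ 2` and radix
`b ≥ 2` over `K`, with `ℓ 0` and `ℓ r` nonzero, and primitive (the coefficients have gcd `1`).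
Only the values `ℓ 0, …, ℓ r` are used. -/
structure MahlerEquation (K : Type*) [Field K] where
  b : ℕ
  two_le_b : 2 ≤ b
  r : ℕ
  two_le_r : 2 ≤ r
  ℓ : ℕ → K[X]
  ℓ_zero_ne : ℓ 0 ≠ 0
  ℓ_order_ne : ℓ r ≠ 0
  primitive : ∀ p : K[X], (∀ k ≤ r, p ∣ ℓ k) → IsUnit p

theorem MahlerEquation.b_pos {K : Type*} [Field K] (E : MahlerEquation K) : 0 < E.b :=
  lt_of_lt_of_le Nat.zero_lt_two E.two_le_b

theorem expand_nonZeroDivisors (R : Type*) [CommRing R] [IsDomain R] {b : ℕ} (hb : 0 < b) :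
    nonZeroDivisors R[X] ≤ (nonZeroDivisors R[X]).comap (expand R b) := by
  intro p hp
  rw [Submonoid.mem_comap]
  rw [mem_nonZeroDivisors_iff_ne_zero] at hp ⊢
  exact (expand_ne_zero hb).2 hp

/-- The Mahler operator `u(x) ↦ u(x ^ b)` on the fraction field of `R[x]`. -/
def mahler (R : Type*) [CommRing R] [IsDomain R] {b : ℕ} (hb : 0 < b) :
    RatFunc R →+* RatFunc R :=
  RatFunc.mapRingHom (expand R b) (expand_nonZeroDivisors R hb)

section Equation

variable {K : Type*} [Field K] (E : MahlerEquation K)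
variable (L : Type*) [Field L] [Algebra K L]

/-- The coefficient `ℓ k`, viewed over `L`. -/
def MahlerEquation.coeff (k : ℕ) : L[X] := (E.ℓ k).map (algebraMap K L)

/-- The Mahler operator on `L(x)`. -/
def MahlerEquation.M : RatFunc L →+* RatFunc L := mahler L E.b_pos

/-- The solutions `u` in `L(x)` of the Riccati Mahler equation
`∑ k ≤ r, ℓ k * (u * M u * ⋯ * M ^ (k - 1) u) = 0`. -/
def MahlerEquation.riccatiSolutions : Set (RatFunc L) :=
  {u | ∑ k ∈ Finset.range (E.r + 1),
    algebraMap L[X] (RatFunc L) (E.coeff L k) * ∏ j ∈ Finset.range k, (E.M L)^[j] u = 0}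

end Equation

/-! ### Formal parametrizations -/

/-- A rational function `u ∈ L(c₁, …, cₛ)(x)` in `x` and in formal parameters `c₁, …, cₛ`,
together with the number `s` of parameters.
The field `L(c₁, …, cₛ)(x)` is realized as the fraction field of `L[c₁, …, cₛ][x]`. -/
abbrev Param (L : Type*) [Field L] : Type _ := Σ s : ℕ, RatFunc (MvPolynomial (Fin s) L)

/-- `v ∈ L(x)` is the value of the parametrized rational function `p` at `γ ∈ L ^ s`: one can
write `p` as `P / Q` with `P` and `Q` in `L[c₁, …, cₛ][x]` such that `Q(γ, x) ≠ 0` and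
`v = P(γ, x) / Q(γ, x)`. -/
def Param.IsValueAt {L : Type*} [Field L] (p : Param L) (γ : Fin p.1 → L) (v : RatFunc L) :
    Prop :=
  ∃ P Q : (MvPolynomial (Fin p.1) L)[X],
    Q.map (MvPolynomial.eval γ) ≠ 0 ∧
    p.2 = algebraMap _ (RatFunc (MvPolynomial (Fin p.1) L)) P / algebraMap _ _ Q ∧
    v = algebraMap L[X] (RatFunc L) (P.map (MvPolynomial.eval γ)) /
      algebraMap L[X] (RatFunc L) (Q.map (MvPolynomial.eval γ))

/-- The set of rational functions that `p` parametrizes, as the parameters range over the nonzero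
vectors of `L ^ s`. -/
def Param.image {L : Type*} [Field L] (p : Param L) : Set (RatFunc L) :=
  {v | ∃ γ : Fin p.1 → L, γ ≠ 0 ∧ p.IsValueAt γ v}

/-- Evaluation of `p` is everywhere defined on the projective space `ℙ ^ (s - 1) (L)`, and it is
a bijection from this projective space onto the image of `p`. -/
def Param.IsBijectiveParametrization {L : Type*} [Field L] (p : Param L) : Prop :=
  0 < p.1 ∧
  ∃ φ : Projectivization L (Fin p.1 → L) → RatFunc L,
    (∀ (γ : Fin p.1 → L) (hγ : γ ≠ 0), p.IsValueAt γ (φ (Projectivization.mk L γ hγ))) ∧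
    Set.BijOn φ Set.univ p.image

/-! ### Upper Newton polygons -/

section Newton

variable {L : Type*} [Field L]

/-- For the operator `∑ k ≤ r, p k * M ^ k`, the points of the Newton polygon are the
`(b ^ k, j)` with nonzero coefficient `(p k).coeff j`.
The line `y = m * x + h` carries an edge of their upper convex hull, with end points of abscissae
`b ^ k₁ < b ^ k₂`: no point is above this line, and the extreme points on this line have
abscissae `b ^ k₁` and `b ^ k₂`. -/
structure IsUpperEdge (b r : ℕ) (p : ℕ → L[X]) (k₁ k₂ : ℕ) (m h : ℚ) : Prop where
  lt : k₁ < k₂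
  le : k₂ ≤ r
  below : ∀ k ≤ r, ∀ j ∈ (p k).support, (j : ℚ) ≤ m * (b : ℚ) ^ k + h
  left : ∃ j ∈ (p k₁).support, (j : ℚ) = m * (b : ℚ) ^ k₁ + h
  right : ∃ j ∈ (p k₂).support, (j : ℚ) = m * (b : ℚ) ^ k₂ + h
  between : ∀ k ≤ r, ∀ j ∈ (p k).support, (j : ℚ) = m * (b : ℚ) ^ k + h → k₁ ≤ k ∧ k ≤ k₂

open Classical in
/-- The characteristic polynomial of an edge: the sum of the `(p k).coeff j * X ^ (k - k₁)` over
the points `(b ^ k, j)` of the edge. -/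
def edgeCharPoly (b : ℕ) (p : ℕ → L[X]) (k₁ k₂ : ℕ) (m h : ℚ) : L[X] :=
  ∑ k ∈ Finset.Icc k₁ k₂,
    ∑ j ∈ (p k).support with ((j : ℕ) : ℚ) = m * (b : ℚ) ^ k + h,
      C ((p k).coeff j) * X ^ (k - k₁)

/-- The upper Newton polygon has a `ζ`-admissible edge of slope `m`: an edge whose
characteristic polynomial has `ζ` as a root. -/
def HasAdmissibleEdge (b r : ℕ) (p : ℕ → L[X]) (ζ : L) (m : ℚ) : Prop :=
  ∃ (k₁ k₂ : ℕ) (h : ℚ), IsUpperEdge b r p k₁ k₂ m h ∧ (edgeCharPoly b p k₁ k₂ m h).IsRoot ζ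

/-- The set of the roots in `L` of the characteristic polynomials of the edges of the upper Newton
polygon. -/
def upperRoots (b r : ℕ) (p : ℕ → L[X]) : Set L :=
  {ζ | ∃ m : ℚ, HasAdmissibleEdge b r p ζ m}

/-- For `P = ∑ k ≤ r, p k * M ^ k`, the map `C(t) ↦ P(t, ζ M) C(t) =
∑ k ≤ r, p k(t) * ζ ^ k * C(t ^ (b ^ k))`. -/
def twistedOperator (b r : ℕ) (p : ℕ → L[X]) (ζ : L) : L[X] →ₗ[L] L[X] :=
  ∑ k ∈ Finset.range (r + 1),
    (LinearMap.mulLeft L (p k * C (ζ ^ k))) ∘ₗ (expand L (b ^ k)).toLinearMap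

end Newton

/-! ### The algorithm -/

section Algorithm

variable {K : Type*} [Field K] (E : MahlerEquation K)
variable (L : Type*) [Field L] [Algebra K L]

/-- The coefficient of `M ^ k` in the auxiliary operator attached to `A` and `B`:
`M ^ (r - 1) ℓ k * ∏ j < k, M ^ (r - 1 + j) A * ∏ k ≤ j < r, M ^ j B`. -/
def auxCoeff (A B : L[X]) (k : ℕ) : L[X] :=
  expand L (E.b ^ (E.r - 1)) (E.coeff L k) *
    (∏ j ∈ Finset.range k, expand L (E.b ^ (E.r - 1 + j)) A) *
    ∏ j ∈ Finset.Ico k E.r, expand L (E.b ^ j) B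

/-- The tuples `(A, B, ζ)`, together with the associated degree bound `Δ`, for which the main loop
of the algorithm looks for solutions `C`. -/
structure Iteration where
  A : L[X]
  B : L[X]
  ζ : L
  Δ : ℕ
  A_monic : A.Monic
  A_dvd : A ∣ E.coeff L 0
  B_monic : B.Monic
  B_dvd : B ∣ E.coeff L E.r
  coprime : ∀ i < E.r, IsCoprime (expand L (E.b ^ i) A) B
  ζ_mem : ζ ∈ upperRoots E.b E.r (auxCoeff E L A B)
  /-- `Δ` is the maximum of the integers among the opposites of the slopes of the
  `ζ`-admissible edges (and it is nonnegative, as `Δ : ℕ`). -/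
  Δ_greatest : IsGreatest
    {d : ℤ | HasAdmissibleEdge E.b E.r (auxCoeff E L A B) ζ (-(d : ℚ))} (Δ : ℤ)

variable {E L}

/-- The space of the `C ∈ L[t]` of degree at most `Δ` such that `(auxiliary operator)(t, ζ M) C = 0`. -/
def Iteration.solSpace (i : Iteration E L) : Submodule L L[X] :=
  degreeLE L (i.Δ : WithBot ℕ) ⊓
    LinearMap.ker (twistedOperator E.b E.r (auxCoeff E L i.A i.B) i.ζ)

/-- The dimension of this space of solutions. -/
def Iteration.dim (i : Iteration E L) : ℕ := Module.finrank L i.solSpace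

/-- The polynomial `C = ∑ i, cᵢ * Cᵢ` for formal parameters `cᵢ`. -/
def genericSolution {s : ℕ} (Cs : Fin s → L[X]) : (MvPolynomial (Fin s) L)[X] :=
  ∑ i, C (MvPolynomial.X i) * (Cs i).map (MvPolynomial.C)

/-- The formal rational function
`ζ * (C(t ^ b) / C(t)) * (A(t ^ (b ^ (r - 1))) / B(t))` in `L(c₁, …, cₛ)(t)`, with
`C = ∑ i, cᵢ * Cᵢ`. -/
def Iteration.formalFunction (i : Iteration E L) {s : ℕ} (Cs : Fin s → L[X]) :
    RatFunc (MvPolynomial (Fin s) L) :=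
  RatFunc.C (MvPolynomial.C i.ζ) *
    (algebraMap _ _ (expand (MvPolynomial (Fin s) L) E.b (genericSolution Cs)) /
      algebraMap _ _ (genericSolution Cs)) *
    (algebraMap _ _ ((expand L (E.b ^ (E.r - 1)) i.A).map (MvPolynomial.C (σ := Fin s))) /
      algebraMap _ _ (i.B.map (MvPolynomial.C (σ := Fin s))))

variable (E L)

/-- A choice of the bases computed in the main loop. -/
abbrev BasisChoice : Type _ := ∀ i : Iteration E L, Module.Basis (Fin i.dim) L i.solSpace

variable {E L}

/-- `u(x)` is identified from the formal function `ũ(t)` of the iteration by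
`u(t ^ (b ^ (r - 1))) = ũ(t)`. -/
def IsIdentified (β : BasisChoice E L) (i : Iteration E L)
    (u : RatFunc (MvPolynomial (Fin i.dim) L)) : Prop :=
  (mahler (MvPolynomial (Fin i.dim) L) E.b_pos)^[E.r - 1] u =
    i.formalFunction fun j => (β i j : L[X])

/-- The set of parametrizations gathered by the main loop. -/
def candidates (β : BasisChoice E L) : Set (Param L) :=
  {p | ∃ (i : Iteration E L) (u : RatFunc (MvPolynomial (Fin i.dim) L)),
    0 < i.dim ∧ IsIdentified β i u ∧ p = ⟨i.dim, u⟩}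

/-- One pass through the cleaning loop: if `𝒰` contains two distinct elements `p` and `q` with
inclusion of `p` in `q`, remove `p` from `𝒰`. -/
def CleaningStep (𝒰 𝒰' : Set (Param L)) : Prop :=
  ∃ p ∈ 𝒰, ∃ q ∈ 𝒰, p ≠ q ∧ p.image ⊆ q.image ∧ 𝒰' = 𝒰 \ {p}

variable (E L)

/-- `𝒰` is a possible output of the algorithm: for some choice of the bases, it is obtained from
the set gathered by the main loop by running the cleaning loop until it stops. -/
def IsOutput (𝒰 : Set (Param L)) : Prop :=
  ∃ β : BasisChoice E L,
    Relation.ReflTransGen CleaningStep (candidates β) 𝒰 ∧ ¬ ∃ 𝒰', CleaningStep 𝒰 𝒰'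

/-- The algorithm executes without failure and terminates: the main loop is finite, the required
bases exist, each identification of a rational function `u(x)` with `u(t ^ (b ^ (r - 1))) = ũ(t)`
succeeds with a unique result, and the cleaning loop cannot be run forever, whatever choices are
made. -/
def Terminates : Prop :=
  Finite (Iteration E L) ∧
  (∀ i : Iteration E L, Module.Finite L i.solSpace) ∧
  Nonempty (BasisChoice E L) ∧
  (∀ (β : BasisChoice E L) (i : Iteration E L), 0 < i.dim → ∃! u, IsIdentified β i u) ∧
  (∀ β : BasisChoice E L,
    Acc (fun 𝒰' 𝒰 : Set (Param L) => CleaningStep 𝒰 𝒰') (candidates β))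

end Algorithm

/-! ### Puiseux series, the difference ring of generalized series, and blocks -/

section Blocks

/-- The group homomorphism `n ↦ n / q` from `ℤ` to `ℚ`. -/
def divHom (q : ℕ) : ℤ →+ ℚ where
  toFun n := (n : ℚ) / q
  map_zero' := by simp
  map_add' m n := by push_cast; ring

theorem divHom_le {q : ℕ} (hq : 0 < q) (m n : ℤ) : divHom q m ≤ divHom q n ↔ m ≤ n := by
  have h : (0 : ℚ) < q := by exact_mod_cast hq
  change (m : ℚ) / q ≤ (n : ℚ) / q ↔ m ≤ n
  rw [div_le_div_iff_of_pos_right h]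
  exact_mod_cast Iff.rfl

theorem divHom_injective {q : ℕ} (hq : 0 < q) : Function.Injective (divHom q) := fun m n h =>
  le_antisymm ((divHom_le hq m n).1 h.le) ((divHom_le hq n m).1 h.ge)

theorem embDomain_embDomain {Γ₁ Γ₂ Γ₃ L : Type*} [PartialOrder Γ₁] [PartialOrder Γ₂]
    [PartialOrder Γ₃] [Zero L] {f : Γ₁ ↪o Γ₂} {g : Γ₂ ↪o Γ₃} {h : Γ₁ ↪o Γ₃}
    (hfg : ∀ a, g (f a) = h a) (x : HahnSeries Γ₁ L) :
    HahnSeries.embDomain g (HahnSeries.embDomain f x) = HahnSeries.embDomain h x := by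
  ext a
  by_cases ha : a ∈ Set.range g
  · obtain ⟨b, rfl⟩ := ha
    rw [HahnSeries.embDomain_coeff]
    by_cases hb : b ∈ Set.range f
    · obtain ⟨c, rfl⟩ := hb
      rw [HahnSeries.embDomain_coeff, hfg, HahnSeries.embDomain_coeff]
    · rw [HahnSeries.embDomain_of_notMem_range hb, HahnSeries.embDomain_of_notMem_range]
      rintro ⟨c, hc⟩
      exact hb ⟨c, g.injective ((hfg c).trans hc)⟩
  · rw [HahnSeries.embDomain_of_notMem_range ha, HahnSeries.embDomain_of_notMem_range]
    rintro ⟨c, hc⟩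
    exact ha ⟨f c, (hfg c).trans hc⟩

variable (L : Type*) [Field L]

/-- The embedding `f(x) ↦ f(x ^ (1 / q))` of Laurent series into series with rational
exponents; its range is `L((x ^ (1 / q)))`. -/
def ramify {q : ℕ} (hq : 0 < q) : LaurentSeries L →+* HahnSeries ℚ L :=
  HahnSeries.embDomainRingHom (divHom q) (divHom_injective hq) (divHom_le hq)

theorem ramify_range_le {q q' : ℕ} (hq : 0 < q) (hq' : 0 < q') :
    (ramify L hq).fieldRange ≤ (ramify L (Nat.mul_pos hq hq')).fieldRange := by
  rintro _ ⟨f, rfl⟩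
  have hle : ∀ m n : ℤ, AddMonoidHom.mulLeft (q' : ℤ) m ≤ AddMonoidHom.mulLeft (q' : ℤ) n ↔
      m ≤ n := fun m n => mul_le_mul_iff_right₀ (by exact_mod_cast hq')
  have hinj : Function.Injective (AddMonoidHom.mulLeft (q' : ℤ)) := fun m n h =>
    le_antisymm ((hle m n).1 h.le) ((hle n m).1 h.ge)
  refine ⟨HahnSeries.embDomainRingHom (AddMonoidHom.mulLeft (q' : ℤ)) hinj hle f, ?_⟩
  refine embDomain_embDomain (fun n => ?_) f
  have hq0 : (q : ℚ) ≠ 0 := by exact_mod_cast hq.ne'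
  have hq0' : (q' : ℚ) ≠ 0 := by exact_mod_cast hq'.ne'
  change (((q' : ℤ) * n : ℤ) : ℚ) / ((q * q' : ℕ) : ℚ) = (n : ℚ) / q
  push_cast
  field_simp

theorem ramify_range_le' {q q' : ℕ} (hq : 0 < q) (hq' : 0 < q') :
    (ramify L hq').fieldRange ≤ (ramify L (Nat.mul_pos hq hq')).fieldRange := by
  have h : ∀ {n m : ℕ} (hn : 0 < n) (hm : 0 < m), n = m →
      (ramify L hn).fieldRange ≤ (ramify L hm).fieldRange := by
    rintro n _ hn hm rfl
    exact le_rfl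
  exact (ramify_range_le L hq' hq).trans (h _ _ (Nat.mul_comm q' q))

/-- The field of Puiseux series over `L`, the union of the `L((x ^ (1 / q)))` for `q ≥ 1`. -/
def puiseux : Subfield (HahnSeries ℚ L) where
  carrier := {f | ∃ (q : ℕ) (hq : 0 < q), f ∈ (ramify L hq).fieldRange}
  mul_mem' := by
    rintro f g ⟨q, hq, hf⟩ ⟨q', hq', hg⟩
    exact ⟨q * q', Nat.mul_pos hq hq',
      mul_mem (ramify_range_le L hq hq' hf) (ramify_range_le' L hq hq' hg)⟩
  one_mem' := ⟨1, Nat.one_pos, one_mem _⟩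
  add_mem' := by
    rintro f g ⟨q, hq, hf⟩ ⟨q', hq', hg⟩
    exact ⟨q * q', Nat.mul_pos hq hq',
      add_mem (ramify_range_le L hq hq' hf) (ramify_range_le' L hq hq' hg)⟩
  zero_mem' := ⟨1, Nat.one_pos, zero_mem _⟩
  neg_mem' := by
    rintro f ⟨q, hq, hf⟩
    exact ⟨q, hq, neg_mem hf⟩
  inv_mem' := by
    rintro f ⟨q, hq, hf⟩
    exact ⟨q, hq, inv_mem hf⟩

/-- The field of Puiseux series, as a type. -/
abbrev Puiseux : Type _ := puiseux L

/-- The inclusion of `L(x)` into `L((x))`. -/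
def ratToLaurent : RatFunc L →+* LaurentSeries L :=
  IsFractionRing.lift (FaithfulSMul.algebraMap_injective L[X] (LaurentSeries L))

/-- The inclusion of `L(x)` into the field of Puiseux series. -/
def ratToPuiseux : RatFunc L →+* Puiseux L :=
  ((ramify L Nat.one_pos).comp (ratToLaurent L)).codRestrict (puiseux L)
    fun u => ⟨1, Nat.one_pos, ⟨ratToLaurent L u, rfl⟩⟩

theorem mulLeft_le {b : ℕ} (hb : 0 < b) (x y : ℚ) :
    AddMonoidHom.mulLeft (b : ℚ) x ≤ AddMonoidHom.mulLeft (b : ℚ) y ↔ x ≤ y :=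
  mul_le_mul_iff_right₀ (by exact_mod_cast hb)

theorem mulLeft_injective {b : ℕ} (hb : 0 < b) :
    Function.Injective (AddMonoidHom.mulLeft (b : ℚ)) := fun x y h =>
  le_antisymm ((mulLeft_le hb x y).1 h.le) ((mulLeft_le hb y x).1 h.ge)

/-- The Mahler operator `f(x) ↦ f(x ^ b)` on series with rational exponents. -/
def mahlerHahn {b : ℕ} (hb : 0 < b) : HahnSeries ℚ L →+* HahnSeries ℚ L :=
  HahnSeries.embDomainRingHom (AddMonoidHom.mulLeft (b : ℚ)) (mulLeft_injective hb) (mulLeft_le hb)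

theorem mahlerHahn_mem {b : ℕ} (hb : 0 < b) (f : Puiseux L) :
    mahlerHahn L hb (f : HahnSeries ℚ L) ∈ puiseux L := by
  obtain ⟨_, q, hq, f, rfl⟩ := f
  have hle : ∀ m n : ℤ, AddMonoidHom.mulLeft (b : ℤ) m ≤ AddMonoidHom.mulLeft (b : ℤ) n ↔
      m ≤ n := fun m n => mul_le_mul_iff_right₀ (by exact_mod_cast hb)
  have hinj : Function.Injective (AddMonoidHom.mulLeft (b : ℤ)) := fun m n h =>
    le_antisymm ((hle m n).1 h.le) ((hle n m).1 h.ge)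
  refine ⟨q, hq, HahnSeries.embDomainRingHom (AddMonoidHom.mulLeft (b : ℤ)) hinj hle f, ?_⟩
  have hcomp : ∀ n : ℤ, divHom q (AddMonoidHom.mulLeft (b : ℤ) n) =
      AddMonoidHom.mulLeft (b : ℚ) (divHom q n) := by
    intro n
    change (((b : ℤ) * n : ℤ) : ℚ) / q = (b : ℚ) * ((n : ℚ) / q)
    push_cast
    ring
  refine (embDomain_embDomain (h := ⟨⟨fun n : ℤ => AddMonoidHom.mulLeft (b : ℚ) (divHom q n),
    (mulLeft_injective hb).comp (divHom_injective hq)⟩,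
    (mulLeft_le hb _ _).trans (divHom_le hq _ _)⟩) hcomp f).trans ?_
  exact (embDomain_embDomain (fun _ => rfl) f).symm

/-- The Mahler operator on the field of Puiseux series. -/
def mahlerPuiseux {b : ℕ} (hb : 0 < b) : Puiseux L →+* Puiseux L :=
  ((mahlerHahn L hb).comp (puiseux L).subtype).codRestrict (puiseux L) (mahlerHahn_mem L hb)

/-- The ring `⨁ e_λ * Puiseux(L)` for `λ ∈ Lˣ`, with `e_λ * e_μ = e_(λ * μ)` and `e_1 = 1`: the
group algebra of `Lˣ` over the field of Puiseux series. -/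
abbrev GenSeries : Type _ := MonoidAlgebra (Puiseux L) Lˣ

/-- The inclusion of `L(x)` into the ring of generalized series. -/
def ratToGenSeries : RatFunc L →+* GenSeries L :=
  MonoidAlgebra.singleOneRingHom.comp (ratToPuiseux L)

/-- A constant of `L`, as a Puiseux series. -/
def constPuiseux : L →+* Puiseux L := (ratToPuiseux L).comp RatFunc.C

/-- The Mahler operator on the ring of generalized series: it is the given one on Puiseux series,
and `M e_λ = λ * e_λ`. -/
def mahlerGenSeries {b : ℕ} (hb : 0 < b) : GenSeries L →+* GenSeries L :=
  MonoidAlgebra.liftNCRingHom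
    (MonoidAlgebra.singleOneRingHom.comp (mahlerPuiseux L hb))
    { toFun := fun a => MonoidAlgebra.single a (constPuiseux L (a : L))
      map_one' := by
        rw [Units.val_one, map_one]
        rfl
      map_mul' := fun a c => by
        rw [MonoidAlgebra.single_mul_single, Units.val_mul, map_mul] }
    fun _ _ => mul_comm _ _

variable {L}
variable {K : Type*} [Field K] (E : MahlerEquation K)

/-- `y` is a solution of the linear Mahler equation `∑ k ≤ r, ℓ k * M ^ k y = 0`. -/
def IsLinearSolution [Algebra K L] (y : GenSeries L) : Prop :=
  ∑ k ∈ Finset.range (E.r + 1),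
    ratToGenSeries L (algebraMap L[X] (RatFunc L) (E.coeff L k)) *
      (mahlerGenSeries L E.b_pos)^[k] y = 0

/-- `M y = u y`, for a rational function `u`. -/
def HasQuotient (u : RatFunc L) (y : GenSeries L) : Prop :=
  mahlerGenSeries L E.b_pos y = ratToGenSeries L u * y

variable (L)

/-- The nonzero `L(x)`-hypergeometric solutions of the linear Mahler equation. -/
def hypergeometricSolutions [Algebra K L] : Set (GenSeries L) :=
  {y | y ≠ 0 ∧ IsLinearSolution E y ∧ ∃ u : RatFunc L, HasQuotient E u y}

variable {L}

/-- `L(x)`-similarity. -/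
def Similar (y₁ y₂ : GenSeries L) : Prop :=
  ∃ q : RatFunc L, q ≠ 0 ∧ y₁ = ratToGenSeries L q * y₂

variable (L)

/-- The blocks: the images under `y ↦ M y / y` of the similarity classes of nonzero hypergeometric
solutions of the linear Mahler equation. -/
def blocks [Algebra K L] : Set (Set (RatFunc L)) :=
  {𝔅 | ∃ y₀ ∈ hypergeometricSolutions L E,
    𝔅 = {u | ∃ y ∈ hypergeometricSolutions L E, Similar y y₀ ∧ HasQuotient E u y}}

end Blocks

end MahlerBP

end

noncomputable section

namespace MahlerBP

open Polynomial

/-! ### Iterates of ring endomorphisms -/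

/-! Write `M` for the substitution and let `m = r - 1`. Since `ℓ 0 ≠ 0`, a Riccati solution `u` is
nonzero.

Completeness of the search. Cancelling common factors `m` times between the numerator and the
successive images of the denominator puts `M^m u` in the form `ζ (M c / c) (M^m A / B)`, where `M^i
A` is coprime to `B` for `i < r`, `M^m A` to `c`, and `B` to `M c` (`exists_formFunction_eq`).
Substituting this and clearing denominators turns the Riccati equation into the auxiliary equation
for `c`. Coprimality in its first and last terms gives `A ∣ ℓ 0` and `B ∣ ℓ r`. Cancellation of its
leading terms makes `-deg c` the slope of a `ζ`-admissible edge. Hence the main loop meets every `u`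
(`exists_iteration`).

Soundness. Conversely, a nonzero solution `c` yields a function satisfying the Riccati equation with
coefficients `M^m ℓ k`. Such a function lies in the image of `M^m` (`mem_fieldRange_of_riccati`),
also when `c` has formal parameters, so `u(x)` exists; it is unique because `M` is injective. Two
choices of `c` give the same function exactly when they are proportional, because only constants are
fixed by `M`; this is the bijection with projective space.

Blocks. For every `u ≠ 0` the equation `M y = u y` has a nonzero solution `e_λ f` with `f` a Puiseux
series. So blocks are exactly the classes of Riccati solutions modulo factors `M q / q`
(`blocks_eq`). One iteration produces values in a single class. A class is parametrized by the
nonzero vectors `q` of an `L`-vector space, in which each iteration cuts out a subspace; finitely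
many of them cover the space. As `L` is infinite, one of them is everything: some single iteration
yields the whole class (`exists_values_eq_riccatiClass`). Cleaning therefore never loses a class,
and when it stops exactly one element per class is left. -/

theorem pow_add_apply {R : Type*} [Semiring R] (σ : R →+* R) (i j : ℕ) (x : R) :
    (σ ^ (i + j)) x = (σ ^ i) ((σ ^ j) x) := by
  rw [pow_add]
  rfl

theorem pow_succ_apply {R : Type*} [Semiring R] (σ : R →+* R) (i : ℕ) (x : R) :
    (σ ^ (i + 1)) x = σ ((σ ^ i) x) := by
  rw [add_comm, pow_add_apply, pow_one]

section Descent

variable {F : Type*} [Field F] (σ : F →+* F)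

theorem fieldRange_pow_anti {i j : ℕ} (h : i ≤ j) : (σ ^ j).fieldRange ≤ (σ ^ i).fieldRange := by
  rintro _ ⟨x, rfl⟩
  obtain ⟨k, rfl⟩ := Nat.exists_eq_add_of_le h
  exact ⟨(σ ^ k) x, (pow_add_apply σ i k x).symm⟩

theorem pow_succ_mem_fieldRange {j : ℕ} (i : ℕ) {x : F} (hx : x ∈ (σ ^ j).fieldRange) :
    (σ ^ (i + 1)) x ∈ (σ ^ (j + 1)).fieldRange := by
  obtain ⟨y, rfl⟩ := hx
  exact ⟨(σ ^ i) y, by rw [← pow_add_apply, ← pow_add_apply]; congr 2; omega⟩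

/-- Every term but the one for `k = 0` contains `u`, and the cofactor of `u` involves `u` only
through `σ u, σ² u, …`. Solving for `u` thus shows that membership in the range of `σ ^ j` improves
to `σ ^ (j + 1)`, as long as the coefficients, in the range of `σ ^ m`, allow it. -/
theorem mem_fieldRange_of_riccati (m r : ℕ) (a : ℕ → F) (ha : a 0 ≠ 0) {u : F}
    (h : ∑ k ∈ Finset.range (r + 1), (σ ^ m) (a k) * ∏ j ∈ Finset.range k, (σ ^ j) u = 0) :
    u ∈ (σ ^ m).fieldRange := by
  suffices H : ∀ j ≤ m, u ∈ (σ ^ j).fieldRange from H m le_rfl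
  intro j
  induction j with
  | zero => exact fun _ => ⟨u, rfl⟩
  | succ j ih =>
    intro hj
    have hu := ih (by omega)
    have hS : (∑ k ∈ Finset.range r,
        (σ ^ m) (a (k + 1)) * ∏ i ∈ Finset.range k, (σ ^ (i + 1)) u) ∈ (σ ^ (j + 1)).fieldRange :=
      sum_mem fun k _ => mul_mem (fieldRange_pow_anti σ hj ⟨_, rfl⟩)
        (prod_mem fun i _ => pow_succ_mem_fieldRange σ i hu)
    set S := ∑ k ∈ Finset.range r,
      (σ ^ m) (a (k + 1)) * ∏ i ∈ Finset.range k, (σ ^ (i + 1)) u with hSdef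
    have key : S * u = -(σ ^ m) (a 0) := by
      rw [Finset.sum_range_succ] at h
      rw [← Finset.sum_range_succ, Finset.sum_range_succ'] at h
      simp only [Finset.prod_range_succ', pow_zero, Finset.prod_range_zero, mul_one] at h
      rw [hSdef, Finset.sum_mul, eq_neg_iff_add_eq_zero, ← h]
      congr 1
      exact Finset.sum_congr rfl fun k _ => by rw [mul_assoc]; rfl
    have hne : -(σ ^ m) (a 0) ≠ 0 := neg_ne_zero.2 ((_root_.map_ne_zero _).2 ha)
    have hS0 : S ≠ 0 := fun h0 => hne (by rw [← key, h0, zero_mul])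
    rw [show u = -(σ ^ m) (a 0) / S by rw [← key]; field_simp]
    exact div_mem (neg_mem (fieldRange_pow_anti σ hj ⟨_, rfl⟩)) hS

/-- The same bootstrapping, applied to `w = σ w / (σ ^ m) g`. -/
theorem mem_fieldRange_of_map_eq_mul (m : ℕ) {g w : F} (hw : w ≠ 0) (h : σ w = (σ ^ m) g * w) :
    w ∈ (σ ^ m).fieldRange := by
  suffices H : ∀ j ≤ m, w ∈ (σ ^ j).fieldRange from H m le_rfl
  intro j
  induction j with
  | zero => exact fun _ => ⟨w, rfl⟩
  | succ j ih =>
    intro hj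
    have hw' : σ w ∈ (σ ^ (j + 1)).fieldRange := by
      simpa using pow_succ_mem_fieldRange σ 0 (ih (by omega))
    have hg : (σ ^ m) g ≠ 0 := fun h0 => (_root_.map_ne_zero σ).2 hw (by rw [h, h0, zero_mul])
    rw [show w = σ w / (σ ^ m) g by rw [h]; field_simp]
    exact div_mem hw' (fieldRange_pow_anti σ hj ⟨_, rfl⟩)

end Descent

/-! ### Gosper–Petkovšek forms -/

section Chain

variable {R : Type*} [CommRing R] (σ : R →+* R)

/-- The polynomial `C` of the Gosper–Petkovšek form obtained from the successive cancelled
factors `γ`. -/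
def chainCertificate (m : ℕ) (γ : ℕ → R) : R :=
  ∏ l ∈ Finset.range m, ∏ i ∈ Finset.range (l + 1), (σ ^ (m - 1 - l + i)) (γ l)

theorem map_chainCertificate (m : ℕ) (γ : ℕ → R) :
    σ (chainCertificate σ m γ) =
      ∏ l ∈ Finset.range m, ∏ i ∈ Finset.range (l + 1), (σ ^ (m - 1 - l + i + 1)) (γ l) := by
  simp only [chainCertificate, map_prod, ← pow_succ_apply]

/-- For fixed `l`, the powers of `σ` applied to `γ l` run from `m - 1 - l` to `m - 1` in the
certificate and from `m - l` to `m` in its image. The quotient telescopes to the two extreme powers.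
These are the powers by which `(σ ^ m) (α 0)` and `(σ ^ m) (δ 0)` differ from `(σ ^ m) (α m)` and `δ
m`. -/
theorem map_chainCertificate_mul (m : ℕ) (γ : ℕ → R) :
    σ (chainCertificate σ m γ) * ∏ l ∈ Finset.range m, (σ ^ (m - 1 - l)) (γ l) =
      chainCertificate σ m γ * ∏ l ∈ Finset.range m, (σ ^ m) (γ l) := by
  rw [map_chainCertificate, chainCertificate, ← Finset.prod_mul_distrib,
    ← Finset.prod_mul_distrib]
  refine Finset.prod_congr rfl fun l hl => ?_
  have h1 := Finset.prod_range_succ' (fun i => (σ ^ (m - 1 - l + i)) (γ l)) (l + 1)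
  have h2 := Finset.prod_range_succ (fun i => (σ ^ (m - 1 - l + i)) (γ l)) (l + 1)
  have h3 : m - 1 - l + (l + 1) = m := by have := Finset.mem_range.1 hl; omega
  rw [h3] at h2
  exact h1.symm.trans h2

theorem chain_eq_mul_prod {α γ : ℕ → R} (hα : ∀ j, α j = α (j + 1) * γ j) (n : ℕ) :
    α 0 = α n * ∏ l ∈ Finset.range n, γ l := by
  induction n with
  | zero => simp
  | succ n ih => rw [ih, Finset.prod_range_succ, hα n]; ring

theorem chain_pow_eq_mul_prod {δ γ : ℕ → R} (hδ : ∀ j, σ (δ j) = δ (j + 1) * γ j) (n : ℕ) :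
    (σ ^ n) (δ 0) = δ n * ∏ l ∈ Finset.range n, (σ ^ (n - 1 - l)) (γ l) := by
  induction n with
  | zero => simp
  | succ n ih =>
    have : ∀ l ∈ Finset.range n, σ ((σ ^ (n - 1 - l)) (γ l)) = (σ ^ (n - l)) (γ l) := by
      intro l hl
      rw [← pow_succ_apply]
      have := Finset.mem_range.1 hl
      congr 2
      omega
    rw [pow_succ_apply, ih, map_mul, hδ, Finset.prod_range_succ, map_prod,
      Finset.prod_congr rfl this, Nat.add_sub_cancel, Nat.sub_self, pow_zero, RingHom.coe_one, id]
    ring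

theorem chain_dvd {α γ : ℕ → R} (hα : ∀ j, α j = α (j + 1) * γ j) (i j : ℕ) :
    α (j + i) ∣ α j := by
  induction i with
  | zero => exact dvd_rfl
  | succ i ih => exact (Dvd.intro _ (hα (j + i)).symm).trans ih

theorem chain_dvd_pow {δ γ : ℕ → R} (hδ : ∀ j, σ (δ j) = δ (j + 1) * γ j) (i j : ℕ) :
    δ (j + i) ∣ (σ ^ i) (δ j) := by
  induction i with
  | zero => exact dvd_rfl
  | succ i ih =>
    rw [pow_succ_apply]
    exact (Dvd.intro _ (hδ (j + i)).symm).trans (map_dvd _ ih)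

theorem chain_factor_dvd_pow {δ γ : ℕ → R} (hδ : ∀ j, σ (δ j) = δ (j + 1) * γ j) (i l : ℕ) :
    γ (l + i) ∣ (σ ^ (i + 1)) (δ l) := by
  rw [pow_succ_apply]
  exact (Dvd.intro_left _ (hδ (l + i)).symm).trans (map_dvd _ (chain_dvd_pow σ hδ i l))

variable {α δ γ : ℕ → R} (hα : ∀ j, α j = α (j + 1) * γ j)
  (hδ : ∀ j, σ (δ j) = δ (j + 1) * γ j) (hcop : ∀ j, IsCoprime (α j) (δ j))
include hα hcop

theorem isCoprime_chain_pow (i : ℕ) {j k : ℕ} {p : R} (hp : p ∣ α (j + k)) :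
    IsCoprime ((σ ^ i) p) ((σ ^ i) (δ j)) :=
  IsCoprime.of_isCoprime_of_dvd_left ((hcop j).map (σ ^ i))
    (map_dvd (σ ^ i) (hp.trans (chain_dvd hα k j)))

include hδ

/-- `α m` divides `α (m - i)` and `δ m` divides `(σ ^ i) (δ (m - i))`, so the claim is the image
under `σ ^ i` of coprimality at stage `m - i`. -/
theorem isCoprime_chain_pow_left {m i : ℕ} (hi : i ≤ m) : IsCoprime ((σ ^ i) (α m)) (δ m) := by
  refine IsCoprime.of_isCoprime_of_dvd_right
    (isCoprime_chain_pow σ hα hcop i (j := m - i) (k := i) ?_) ?_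
  · rw [Nat.sub_add_cancel hi]
  · have := chain_dvd_pow σ hδ i (m - i)
    rwa [Nat.sub_add_cancel hi] at this

theorem isCoprime_chainCertificate (m : ℕ) :
    IsCoprime ((σ ^ m) (α m)) (chainCertificate σ m γ) := by
  refine IsCoprime.prod_right fun l hl => IsCoprime.prod_right fun i hi => ?_
  have hl' := Finset.mem_range.1 hl
  have hi' := Finset.mem_range.1 hi
  -- Coprimality is imported from stage `i`: the factor `(σ ^ (m - 1 - l + i)) (γ l)` divides `(σ ^
  -- m) (δ i)`.
  refine IsCoprime.of_isCoprime_of_dvd_right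
    (isCoprime_chain_pow σ hα hcop m (j := i) (k := m - i) ?_) (y := (σ ^ m) (δ i)) ?_
  · rw [Nat.add_sub_cancel' (by omega)]
  · have h := map_dvd (σ ^ (m - 1 - l + i)) (chain_factor_dvd_pow σ hδ (l - i) i)
    rw [← pow_add_apply, Nat.add_sub_cancel' (by omega)] at h
    rwa [show m - 1 - l + i + (l - i + 1) = m by omega] at h

theorem isCoprime_map_chainCertificate (m : ℕ) :
    IsCoprime (δ m) (σ (chainCertificate σ m γ)) := by
  rw [map_chainCertificate]
  refine IsCoprime.prod_right fun l hl => IsCoprime.prod_right fun i hi => ?_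
  have hl' := Finset.mem_range.1 hl
  have hi' := Finset.mem_range.1 hi
  -- Here stage `l - i` is used: `γ l` divides `α l`, hence `α (l - i)`, while `δ m` divides `(σ ^
  -- (m - l + i)) (δ (l - i))`.
  refine IsCoprime.symm (IsCoprime.of_isCoprime_of_dvd_right
    (isCoprime_chain_pow σ hα hcop (m - 1 - l + i + 1) (j := l - i) (k := i) ?_) ?_)
  · rw [Nat.sub_add_cancel (by omega)]
    exact Dvd.intro_left _ (hα l).symm
  · have h := chain_dvd_pow σ hδ (m - 1 - l + i + 1) (l - i)
    rwa [show l - i + (m - 1 - l + i + 1) = m by omega] at h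

end Chain

section GosperPetkovsek

variable {L : Type*} [Field L]

theorem exists_monic_gcd_factorization {a d : L[X]} (ha : a.Monic) (hd : d.Monic) :
    ∃ a' d' g : L[X], a'.Monic ∧ d'.Monic ∧ g.Monic ∧ IsCoprime a' d' ∧
      a = a' * g ∧ d = d' * g := by
  classical
  set g := normalize (EuclideanDomain.gcd a d) with hg
  have hg0 : EuclideanDomain.gcd a d ≠ 0 := fun h0 =>
    hd.ne_zero (EuclideanDomain.gcd_eq_zero_iff.1 h0).2
  have hgm : g.Monic := monic_normalize hg0
  obtain ⟨a', ha'⟩ : g ∣ a := normalize_dvd_iff.2 (EuclideanDomain.gcd_dvd_left a d)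
  obtain ⟨d', hd'⟩ : g ∣ d := normalize_dvd_iff.2 (EuclideanDomain.gcd_dvd_right a d)
  refine ⟨a', d', g, ?_, ?_, hgm, ?_, by rw [ha', mul_comm], by rw [hd', mul_comm]⟩
  · exact hgm.of_mul_monic_left (ha' ▸ ha)
  · exact hgm.of_mul_monic_left (hd' ▸ hd)
  · obtain ⟨v, hv⟩ : EuclideanDomain.gcd a d ∣ g := dvd_normalize_iff.2 dvd_rfl
    refine ⟨EuclideanDomain.gcdA a d * v, EuclideanDomain.gcdB a d * v, ?_⟩
    have h := EuclideanDomain.gcd_eq_gcd_ab a d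
    apply mul_left_cancel₀ hgm.ne_zero
    calc g * (EuclideanDomain.gcdA a d * v * a' + EuclideanDomain.gcdB a d * v * d')
        = (g * a' * EuclideanDomain.gcdA a d + g * d' * EuclideanDomain.gcdB a d) * v := by ring
      _ = g * 1 := by rw [← ha', ← hd', ← h, ← hv, mul_one]

variable (σ : L[X] →+* L[X]) (hσ : ∀ p : L[X], p.Monic → (σ p).Monic)
include hσ

/-- At each stage `γ j` is the monic gcd of `α j` and `σ (δ j)`, and both are divided by it; the two
quotients are coprime. -/
theorem exists_cancellation_chain {a d : L[X]} (ha : a.Monic) (hd : d.Monic)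
    (had : IsCoprime a d) :
    ∃ α δ γ : ℕ → L[X], α 0 = a ∧ δ 0 = d ∧
      (∀ j, (α j).Monic ∧ (δ j).Monic ∧ (γ j).Monic ∧ IsCoprime (α j) (δ j)) ∧
      (∀ j, α j = α (j + 1) * γ j) ∧ ∀ j, σ (δ j) = δ (j + 1) * γ j := by
  let S := {p : L[X] × L[X] // p.1.Monic ∧ p.2.Monic ∧ IsCoprime p.1 p.2}
  have step : ∀ s : S, ∃ (s' : S) (g : L[X]), g.Monic ∧ s.1.1 = s'.1.1 * g ∧
      σ s.1.2 = s'.1.2 * g := by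
    rintro ⟨⟨x, y⟩, hx, hy, _⟩
    obtain ⟨a', d', g, h1, h2, h3, h4, h5, h6⟩ := exists_monic_gcd_factorization hx (hσ _ hy)
    exact ⟨⟨(a', d'), h1, h2, h4⟩, g, h3, h5, h6⟩
  choose next g hg hnext₁ hnext₂ using step
  let s : ℕ → S := fun n => next^[n] ⟨(a, d), ha, hd, had⟩
  have hs : ∀ n, s (n + 1) = next (s n) := fun n => Function.iterate_succ_apply' _ _ _
  refine ⟨fun n => (s n).1.1, fun n => (s n).1.2, fun n => g (s n), rfl, rfl, fun j => ?_,
    fun j => ?_, fun j => ?_⟩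
  · exact ⟨(s j).2.1, (s j).2.2.1, hg _, (s j).2.2.2⟩
  · dsimp only; rw [hs]; exact hnext₁ _
  · dsimp only; rw [hs]; exact hnext₂ _

theorem exists_gosperPetkovsek (m : ℕ) {a d : L[X]} (ha : a.Monic) (hd : d.Monic)
    (had : IsCoprime a d) :
    ∃ A B c : L[X], A.Monic ∧ B.Monic ∧ c.Monic ∧
      (σ ^ m) a * (c * B) = (σ ^ m) d * (σ c * (σ ^ m) A) ∧
      (∀ i ≤ m, IsCoprime ((σ ^ i) A) B) ∧ IsCoprime ((σ ^ m) A) c ∧ IsCoprime B (σ c) := by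
  obtain ⟨α, δ, γ, rfl, rfl, hm, hα, hδ⟩ := exists_cancellation_chain σ hσ ha hd had
  have hpow : ∀ i (p : L[X]), p.Monic → ((σ ^ i) p).Monic := by
    intro i
    induction i with
    | zero => exact fun p hp => hp
    | succ i ih => exact fun p hp => by rw [pow_succ_apply]; exact hσ _ (ih p hp)
  have hcop := fun j => (hm j).2.2.2
  refine ⟨α m, δ m, chainCertificate σ m γ, (hm m).1, (hm m).2.1, ?_, ?_,
    fun i hi => isCoprime_chain_pow_left σ hα hδ hcop hi,
    isCoprime_chainCertificate σ hα hδ hcop m, isCoprime_map_chainCertificate σ hα hδ hcop m⟩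
  · exact monic_prod_of_monic _ _ fun l _ => monic_prod_of_monic _ _ fun i _ =>
      hpow _ _ (hm l).2.2.1
  · rw [chain_eq_mul_prod hα m, chain_pow_eq_mul_prod σ hδ m, map_mul, map_prod]
    linear_combination (-(σ ^ m) (α m) * δ m) * map_chainCertificate_mul σ m γ

end GosperPetkovsek

/-! ### The Mahler operator -/

section Mahler

theorem expandRingHom_pow_apply {R : Type*} [CommRing R] {b : ℕ} (n : ℕ) (p : R[X]) :
    ((expand R b : R[X] →+* R[X]) ^ n) p = expand R (b ^ n) p := by
  rw [RingHom.coe_pow, expand_pow]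
  rfl

variable {R : Type*} [CommRing R] [IsDomain R] {b : ℕ} (hb : 0 < b)

theorem mahler_algebraMap (p : R[X]) :
    mahler R hb (algebraMap _ _ p) = algebraMap _ _ (expand R b p) := by
  have h := RatFunc.map_apply_div (expand R b) (expand_nonZeroDivisors R hb) p 1
  simp only [map_one, div_one] at h
  exact h

theorem mahler_pow_algebraMap (n : ℕ) (p : R[X]) :
    (mahler R hb ^ n) (algebraMap _ _ p) = algebraMap _ _ (expand R (b ^ n) p) := by
  induction n with
  | zero => simp
  | succ n ih => rw [pow_succ_apply, ih, mahler_algebraMap, expand_expand, pow_succ']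

theorem mahler_C (c : R) : mahler R hb (RatFunc.C c) = RatFunc.C c := by
  rw [← RatFunc.algebraMap_C, mahler_algebraMap, expand_C]

theorem mahler_pow_C (n : ℕ) (c : R) : (mahler R hb ^ n) (RatFunc.C c) = RatFunc.C c := by
  rw [← RatFunc.algebraMap_C, mahler_pow_algebraMap, expand_C]

end Mahler

/-! ### Divisibility and constants under the Mahler operator -/

section Field

variable {L : Type*} [Field L]

theorem expand_dvd_expand_iff {n : ℕ} (hn : n ≠ 0) {p q : L[X]} :
    expand L n p ∣ expand L n q ↔ p ∣ q := by
  refine ⟨fun ⟨c, hc⟩ => ⟨contract n c, ?_⟩, fun ⟨c, hc⟩ => ⟨expand L n c, by rw [hc, map_mul]⟩⟩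
  rw [← contract_expand n hn (f := q), hc, mul_comm, contract_mul_expand hn, mul_comm]

/-- In lowest terms, `M` preserves coprimality of numerator and denominator, so invariance forces
each of them to be divisible by its own image, of degree `b` times larger. Both are therefore
constant. -/
theorem exists_eq_C_of_mahler_eq {b : ℕ} (hb : 2 ≤ b) (hb₀ : 0 < b) {q : RatFunc L}
    (h : mahler L hb₀ q = q) : ∃ c : L, q = RatFunc.C c := by
  by_cases hq : q = 0
  · exact ⟨0, by simp [hq]⟩
  have key : ∀ p : L[X], p ≠ 0 → expand L b p ∣ p → p.natDegree = 0 := by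
    intro p hp hdvd
    have := natDegree_le_of_dvd hdvd hp
    rw [natDegree_expand] at this
    nlinarith
  have hd : algebraMap L[X] (RatFunc L) q.denom ≠ 0 :=
    RatFunc.algebraMap_ne_zero q.denom_ne_zero
  have hd' : algebraMap L[X] (RatFunc L) (expand L b q.denom) ≠ 0 :=
    RatFunc.algebraMap_ne_zero ((expand_ne_zero hb₀).2 q.denom_ne_zero)
  have heq : expand L b q.num * q.denom = q.num * expand L b q.denom := by
    apply RatFunc.algebraMap_injective L
    rw [← RatFunc.num_div_denom q, map_div₀, mahler_algebraMap, mahler_algebraMap,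
      div_eq_div_iff hd' hd] at h
    simpa using h
  have hcop : IsCoprime (expand L b q.num) (expand L b q.denom) :=
    q.isCoprime_num_denom.map (expand L b : L[X] →+* L[X])
  have h1 := key q.num (RatFunc.num_ne_zero hq) (hcop.dvd_of_dvd_mul_right ⟨_, heq.symm⟩)
  have h2 := key q.denom q.denom_ne_zero (hcop.symm.dvd_of_dvd_mul_left
    (Dvd.intro_left _ heq.symm))
  rw [natDegree_eq_zero] at h1 h2
  obtain ⟨x, hx⟩ := h1
  obtain ⟨y, hy⟩ := h2
  exact ⟨x / y, by rw [← RatFunc.num_div_denom q, ← hx, ← hy, RatFunc.algebraMap_C,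
    RatFunc.algebraMap_C, map_div₀]⟩

end Field

/-! ### Hypergeometric forms -/

section Form

variable {F : Type*} [Field F] (σ : F →+* F) (m : ℕ) {A B c z : F}

theorem prod_pow_form (hc : c ≠ 0) (hz : σ z = z) (k : ℕ) :
    ∏ j ∈ Finset.range k, (σ ^ j) (z * (σ c / c) * ((σ ^ m) A / B)) =
      z ^ k * ((σ ^ k) c / c) * ((∏ j ∈ Finset.range k, (σ ^ (m + j)) A) /
        ∏ j ∈ Finset.range k, (σ ^ j) B) := by
  have hz' : ∀ k, (σ ^ k) z = z := by
    intro k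
    induction k with
    | zero => rfl
    | succ k ih => rw [pow_succ_apply, ih, hz]
  induction k with
  | zero => simp [hc]
  | succ k ih =>
    have hk : (σ ^ k) c ≠ 0 := (map_ne_zero (σ ^ k)).2 hc
    have e1 : (σ ^ k) (σ c) = (σ ^ (k + 1)) c := by rw [pow_add_apply, pow_one]
    rw [Finset.prod_range_succ, ih, Finset.prod_range_succ, Finset.prod_range_succ]
    simp only [map_mul, map_div₀, hz', e1, ← pow_add_apply]
    rw [add_comm k m, pow_succ z, mul_div_mul_comm]
    field_simp

theorem form_riccati (hB : B ≠ 0) (hc : c ≠ 0) (hz : σ z = z) (r : ℕ) (a : ℕ → F) :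
    (∏ j ∈ Finset.range r, (σ ^ j) B) * c * ∑ k ∈ Finset.range (r + 1), (σ ^ m) (a k) *
        ∏ j ∈ Finset.range k, (σ ^ j) (z * (σ c / c) * ((σ ^ m) A / B)) =
      ∑ k ∈ Finset.range (r + 1), (σ ^ m) (a k) * (∏ j ∈ Finset.range k, (σ ^ (m + j)) A) *
        (∏ j ∈ Finset.Ico k r, (σ ^ j) B) * z ^ k * (σ ^ k) c := by
  rw [Finset.mul_sum]
  refine Finset.sum_congr rfl fun k hk => ?_
  have hk' : k ≤ r := by have := Finset.mem_range.1 hk; omega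
  rw [prod_pow_form σ m hc hz, ← Finset.prod_range_mul_prod_Ico _ hk']
  have h0 : ∏ j ∈ Finset.range k, (σ ^ j) B ≠ 0 :=
    Finset.prod_ne_zero_iff.2 fun j _ => (map_ne_zero (σ ^ j)).2 hB
  field_simp

end Form

/-! ### From the Riccati equation to the auxiliary operator -/

section AuxiliaryOperator

variable {K : Type*} [Field K] (E : MahlerEquation K)
variable {L : Type*} [Field L]

variable {R : Type*} [CommRing R] [IsDomain R]

/-- The rational function `ζ * (C(t ^ b) / C(t)) * (A(t ^ (b ^ (r - 1))) / B(t))`, for `C` with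
coefficients in an extension `R` of `L`. -/
def formFunction (φ : L →+* R) (A B : L[X]) (ζ : L) (c : R[X]) : RatFunc R :=
  RatFunc.C (φ ζ) * (algebraMap _ _ (expand R E.b c) / algebraMap _ _ c) *
    (algebraMap _ _ ((expand L (E.b ^ (E.r - 1)) A).map φ) / algebraMap _ _ (B.map φ))

theorem formFunction_eq (φ : L →+* R) (A B : L[X]) (ζ : L) (c : R[X]) :
    formFunction E φ A B ζ c =
      RatFunc.C (φ ζ) * (mahler R E.b_pos (algebraMap _ _ c) / algebraMap _ _ c) *
        ((mahler R E.b_pos ^ (E.r - 1)) (algebraMap _ _ (A.map φ)) /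
          algebraMap _ _ (B.map φ)) := by
  rw [mahler_algebraMap, mahler_pow_algebraMap, formFunction, map_expand]

variable [Algebra K L]

theorem MahlerEquation.coeff_zero_ne : E.coeff L 0 ≠ 0 :=
  (Polynomial.map_ne_zero_iff (algebraMap K L).injective).2 E.ℓ_zero_ne

theorem MahlerEquation.coeff_order_ne : E.coeff L E.r ≠ 0 :=
  (Polynomial.map_ne_zero_iff (algebraMap K L).injective).2 E.ℓ_order_ne

theorem twistedOperator_apply (b r : ℕ) (p : ℕ → L[X]) (ζ : L) (c : L[X]) :
    twistedOperator b r p ζ c =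
      ∑ k ∈ Finset.range (r + 1), p k * C (ζ ^ k) * expand L (b ^ k) c := by
  simp [twistedOperator, LinearMap.sum_apply, mul_assoc]

theorem riccati_formFunction (φ : L →+* R) (A : L[X]) {B : L[X]} (hB : B.Monic) (ζ : L)
    {c : R[X]} (hc : c ≠ 0) :
    algebraMap R[X] (RatFunc R) ((∏ j ∈ Finset.range E.r, expand R (E.b ^ j) (B.map φ)) * c) *
      ∑ k ∈ Finset.range (E.r + 1),
        (mahler R E.b_pos ^ (E.r - 1)) (algebraMap _ _ ((E.coeff L k).map φ)) *
          ∏ j ∈ Finset.range k, (mahler R E.b_pos ^ j) (formFunction E φ A B ζ c) =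
      algebraMap _ _ (∑ k ∈ Finset.range (E.r + 1),
        (auxCoeff E L A B k).map φ * C (φ ζ ^ k) * expand R (E.b ^ k) c) := by
  have h := form_riccati (mahler R E.b_pos) (E.r - 1) (A := algebraMap _ _ (A.map φ))
    (B := algebraMap _ _ (B.map φ)) (c := algebraMap _ _ c) (z := RatFunc.C (φ ζ))
    (RatFunc.algebraMap_ne_zero (hB.map φ).ne_zero) (RatFunc.algebraMap_ne_zero hc)
    (mahler_C _ _) E.r (fun k => algebraMap _ _ ((E.coeff L k).map φ))
  rw [← formFunction_eq] at h
  simp only [mahler_pow_algebraMap, ← map_prod, ← RatFunc.algebraMap_C, ← map_mul, ← map_pow,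
    ← map_sum] at h ⊢
  rw [h]
  congr 1
  refine Finset.sum_congr rfl fun k _ => ?_
  simp only [auxCoeff, Polynomial.map_mul, Polynomial.map_prod, map_expand]

theorem riccati_formFunction_eq_zero_iff (φ : L →+* R) (A : L[X]) {B : L[X]} (hB : B.Monic)
    (ζ : L) {c : R[X]} (hc : c ≠ 0) :
    ∑ k ∈ Finset.range (E.r + 1),
        (mahler R E.b_pos ^ (E.r - 1)) (algebraMap _ _ ((E.coeff L k).map φ)) *
          ∏ j ∈ Finset.range k, (mahler R E.b_pos ^ j) (formFunction E φ A B ζ c) = 0 ↔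
      ∑ k ∈ Finset.range (E.r + 1),
        (auxCoeff E L A B k).map φ * C (φ ζ ^ k) * expand R (E.b ^ k) c = 0 := by
  have hne : algebraMap R[X] (RatFunc R)
      ((∏ j ∈ Finset.range E.r, expand R (E.b ^ j) (B.map φ)) * c) ≠ 0 :=
    RatFunc.algebraMap_ne_zero (mul_ne_zero (Finset.prod_ne_zero_iff.2 fun j _ =>
      (expand_ne_zero (pow_pos E.b_pos _)).2 (hB.map φ).ne_zero) hc)
  rw [← map_eq_zero_iff (algebraMap R[X] (RatFunc R)) (RatFunc.algebraMap_injective R),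
    ← riccati_formFunction E φ A hB ζ hc, mul_eq_zero, or_iff_right hne]

/-- This makes the identification of `u(x)` possible. It is needed for `R = L[c₁, …, cₛ]` (formal
parameters) as well as for `R = L` (specialized ones). -/
theorem formFunction_mem_fieldRange (φ : L →+* R) (A : L[X]) {B : L[X]}
    (hB : B.Monic) (ζ : L) {c : R[X]} (hc : c ≠ 0)
    (h : ∑ k ∈ Finset.range (E.r + 1),
      (auxCoeff E L A B k).map φ * C (φ ζ ^ k) * expand R (E.b ^ k) c = 0) :
    formFunction E φ A B ζ c ∈ (mahler R E.b_pos ^ (E.r - 1)).fieldRange :=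
  mem_fieldRange_of_riccati _ _ E.r (fun k => algebraMap _ _ ((E.coeff L k).map φ))
    (RatFunc.algebraMap_ne_zero ((Polynomial.map_ne_zero_iff φ.injective).2 E.coeff_zero_ne))
    ((riccati_formFunction_eq_zero_iff E φ A hB ζ hc).2 h)

theorem mem_riccatiSolutions_iff {u : RatFunc L} :
    u ∈ E.riccatiSolutions L ↔
      ∑ k ∈ Finset.range (E.r + 1), algebraMap _ _ (E.coeff L k) *
        ∏ j ∈ Finset.range k, (mahler L E.b_pos ^ j) u = 0 := by
  simp only [MahlerEquation.riccatiSolutions, MahlerEquation.M, Set.mem_ofPred_eq, RingHom.coe_pow]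

theorem mem_riccatiSolutions_iff_twistedOperator {u : RatFunc L} {A B c : L[X]} {ζ : L}
    (hB : B.Monic) (hc : c ≠ 0)
    (hu : (mahler L E.b_pos ^ (E.r - 1)) u = formFunction E (RingHom.id L) A B ζ c) :
    u ∈ E.riccatiSolutions L ↔ twistedOperator E.b E.r (auxCoeff E L A B) ζ c = 0 := by
  have h := riccati_formFunction_eq_zero_iff E (RingHom.id L) A hB ζ hc
  simp only [Polynomial.map_id, RingHom.id_apply] at h
  rw [twistedOperator_apply, ← h, mem_riccatiSolutions_iff,
    ← map_eq_zero (mahler L E.b_pos ^ (E.r - 1)), map_sum, ← hu]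
  simp only [map_mul, map_prod, ← pow_add_apply, add_comm]

theorem ne_zero_of_mem_riccatiSolutions {u : RatFunc L} (hu : u ∈ E.riccatiSolutions L) :
    u ≠ 0 := by
  rintro rfl
  rw [mem_riccatiSolutions_iff, Finset.sum_range_succ'] at hu
  simp [RatFunc.algebraMap_ne_zero E.coeff_zero_ne] at hu

end AuxiliaryOperator

/-! ### Edges of the upper Newton polygon -/

section Newton

variable {L : Type*} [Field L] {b r : ℕ} {p : ℕ → L[X]}

/-- An edge is determined by its two end points, whose ordinates are bounded by the degrees of the
coefficients. -/
theorem finite_setOf_isUpperEdge (hb : 2 ≤ b) :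
    {e : (ℕ × ℕ) × ℚ × ℚ | IsUpperEdge b r p e.1.1 e.1.2 e.2.1 e.2.2}.Finite := by
  let D := (Finset.range (r + 1)).sup fun k => (p k).natDegree
  let f : (ℕ × ℕ) × ℕ × ℕ → (ℕ × ℕ) × ℚ × ℚ := fun x =>
    let m : ℚ := ((x.2.2 : ℚ) - x.2.1) / ((b : ℚ) ^ x.1.2 - (b : ℚ) ^ x.1.1)
    (x.1, m, x.2.1 - m * (b : ℚ) ^ x.1.1)
  refine (Finset.finite_toSet (((Finset.range (r + 1) ×ˢ Finset.range (r + 1)) ×ˢ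
    Finset.range (D + 1) ×ˢ Finset.range (D + 1)).image f)).subset ?_
  rintro ⟨⟨k₁, k₂⟩, m, h⟩ ⟨lt, le, -, ⟨j₁, hj₁, h₁⟩, ⟨j₂, hj₂, h₂⟩, -⟩
  dsimp only at *
  have hD : ∀ k ≤ r, ∀ j ∈ (p k).support, j ≤ D := fun k hk j hj =>
    (le_natDegree_of_mem_supp j hj).trans
      (Finset.le_sup (f := fun k => (p k).natDegree) (Finset.mem_range.2 (by omega)))
  have hlt : (b : ℚ) ^ k₁ < (b : ℚ) ^ k₂ := pow_lt_pow_right₀ (by exact_mod_cast hb) lt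
  have hm : m = ((j₂ : ℚ) - j₁) / ((b : ℚ) ^ k₂ - (b : ℚ) ^ k₁) := by
    rw [eq_div_iff (sub_ne_zero.2 hlt.ne'), h₁, h₂]
    ring
  refine Finset.mem_coe.2 (Finset.mem_image.2 ⟨((k₁, k₂), j₁, j₂), ?_, ?_⟩)
  · have := hD k₁ (by omega) j₁ hj₁
    have := hD k₂ (by omega) j₂ hj₂
    simp only [Finset.mem_product, Finset.mem_range]
    omega
  · have hh : h = j₁ - m * (b : ℚ) ^ k₁ := by rw [h₁]; ring
    rw [hh]
    simp only [f, ← hm]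

/-- The constant term is the coefficient at the left end point. Hence the characteristic polynomial
is nonzero and `0` is not one of its roots. -/
theorem coeff_zero_edgeCharPoly_ne {k₁ k₂ : ℕ} {m h : ℚ} (he : IsUpperEdge b r p k₁ k₂ m h) :
    (edgeCharPoly b p k₁ k₂ m h).coeff 0 ≠ 0 := by
  classical
  obtain ⟨j, hj, hjm⟩ := he.left
  have hk : k₁ ∈ Finset.Icc k₁ k₂ := Finset.mem_Icc.2 ⟨le_rfl, he.lt.le⟩
  have : (edgeCharPoly b p k₁ k₂ m h).coeff 0 = (p k₁).coeff j := by
    rw [edgeCharPoly, finsetSum_coeff, Finset.sum_eq_single_of_mem k₁ hk, finsetSum_coeff,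
      Finset.sum_eq_single_of_mem j]
    · simp
    · exact Finset.mem_filter.2 ⟨hj, hjm⟩
    · intro i hi hij
      have := (Finset.mem_filter.1 hi).2
      exact absurd (by exact_mod_cast this.trans hjm.symm) hij
    · intro k hk hkk
      have := (Finset.mem_Icc.1 hk).1
      rw [finsetSum_coeff]
      refine Finset.sum_eq_zero fun i _ => ?_
      rw [coeff_C_mul, coeff_X_pow, if_neg (by omega), mul_zero]
  rw [this]
  exact mem_support_iff.1 hj

theorem zero_notMem_upperRoots : (0 : L) ∉ upperRoots b r p := by
  rintro ⟨m, k₁, k₂, h, he, hroot⟩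
  exact coeff_zero_edgeCharPoly_ne he (by rwa [IsRoot, ← coeff_zero_eq_eval_zero] at hroot)

theorem finite_upperRoots (hb : 2 ≤ b) : (upperRoots b r p).Finite := by
  refine ((finite_setOf_isUpperEdge (r := r) (p := p) hb).biUnion fun e he =>
    finite_setOfPred_isRoot (p := edgeCharPoly b p e.1.1 e.1.2 e.2.1 e.2.2) fun h0 =>
      coeff_zero_edgeCharPoly_ne he (by rw [h0, coeff_zero])).subset ?_
  rintro ζ ⟨m, k₁, k₂, h, he, hroot⟩
  exact Set.mem_biUnion (x := ((k₁, k₂), m, h)) he hroot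

theorem finite_admissible_slopes (hb : 2 ≤ b) (ζ : L) :
    {d : ℤ | HasAdmissibleEdge b r p ζ (-(d : ℚ))}.Finite := by
  refine (((finite_setOf_isUpperEdge (r := r) (p := p) hb).image fun e => e.2.1).preimage
    (f := fun d : ℤ => -(d : ℚ)) fun x _ y _ h => by simpa using h).subset ?_
  rintro d ⟨k₁, k₂, h, he, -⟩
  exact ⟨((k₁, k₂), -(d : ℚ), h), he, rfl⟩

/-- With `n = deg c`, the `k`-th term has degree `deg (p k) + n * b ^ k`. The terms of maximal
degree `H` must cancel. They correspond to the points on the supporting line `y = -n x + H`, and the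
vanishing of the sum of their leading coefficients says that `ζ` is a root of the characteristic
polynomial of that edge. -/
theorem hasAdmissibleEdge_of_twistedOperator_eq_zero (hb : 2 ≤ b) (hp : ∃ k ≤ r, p k ≠ 0) {ζ : L}
    (hζ : ζ ≠ 0) {c : L[X]} (hc : c ≠ 0) (h : twistedOperator b r p ζ c = 0) :
    HasAdmissibleEdge b r p ζ (-(c.natDegree : ℚ)) := by
  classical
  set n := c.natDegree with hn
  let S := (Finset.range (r + 1)).filter fun k => p k ≠ 0
  let deg : ℕ → ℕ := fun k => (p k).natDegree + n * b ^ k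
  have hS : S.Nonempty := by
    obtain ⟨k, hk, hpk⟩ := hp
    exact ⟨k, Finset.mem_filter.2 ⟨Finset.mem_range.2 (by omega), hpk⟩⟩
  have memS : ∀ {k}, k ∈ S ↔ k ≤ r ∧ p k ≠ 0 := by
    intro k
    simp only [S, Finset.mem_filter, Finset.mem_range, Nat.lt_succ_iff]
  obtain ⟨k₀, hk₀, hmax⟩ := Finset.exists_max_image S deg hS
  set H := deg k₀ with hH
  let T := S.filter fun k => deg k = H
  have memT : ∀ {k}, k ∈ T ↔ (k ≤ r ∧ p k ≠ 0) ∧ deg k = H := by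
    intro k
    simp only [T, Finset.mem_filter, memS]
  have hT : T.Nonempty := ⟨k₀, memT.2 ⟨memS.1 hk₀, rfl⟩⟩
  have point : ∀ k ≤ r, ∀ j ∈ (p k).support, j + n * b ^ k ≤ H ∧
      (j + n * b ^ k = H → k ∈ T ∧ j = (p k).natDegree) := by
    intro k hk j hj
    have hpk : p k ≠ 0 := fun h0 => by simp [h0] at hj
    have h1 := le_natDegree_of_mem_supp j hj
    have h2 : deg k ≤ H := hmax k (memS.2 ⟨hk, hpk⟩)
    simp only [deg] at h2
    exact ⟨by omega, fun h3 => ⟨memT.2 ⟨⟨hk, hpk⟩, by simp only [deg]; omega⟩, by omega⟩⟩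
  have onLine : ∀ k j : ℕ, ((j : ℚ) = -(n : ℚ) * (b : ℚ) ^ k + (H : ℚ)) ↔ j + n * b ^ k = H := by
    intro k j
    rw [← Nat.cast_inj (R := ℚ)]
    push_cast
    constructor <;> intro h' <;> linarith
  -- The coefficient of degree `H` in the equation, divided by the leading coefficient of `c`.
  have sumT : ∑ k ∈ T, (p k).leadingCoeff * ζ ^ k = 0 := by
    have hcoeff : ∀ k ∈ Finset.range (r + 1), (p k * C (ζ ^ k) * expand L (b ^ k) c).coeff H =
        if k ∈ T then (p k).leadingCoeff * ζ ^ k * c.leadingCoeff else 0 := by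
      intro k hk
      have hkr : k ≤ r := by have := Finset.mem_range.1 hk; omega
      have hd1 : (p k * C (ζ ^ k)).natDegree = (p k).natDegree :=
        natDegree_mul_C (pow_ne_zero _ hζ)
      have hd2 : (expand L (b ^ k) c).natDegree = n * b ^ k := natDegree_expand _ _
      split_ifs with hkT
      · have h1 := (memT.1 hkT).2
        have h2 := coeff_mul_degree_add_degree (p k * C (ζ ^ k)) (expand L (b ^ k) c)
        rw [hd1, hd2] at h2
        rw [← h1]
        simp only [deg]
        rw [h2, leadingCoeff_mul, leadingCoeff_C, leadingCoeff_expand (pow_pos (by omega) _)]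
      · by_cases hpk : p k = 0
        · simp [hpk]
        · apply coeff_eq_zero_of_natDegree_lt
          refine natDegree_mul_le.trans_lt ?_
          rw [hd1, hd2]
          exact lt_of_le_of_ne (hmax k (memS.2 ⟨hkr, hpk⟩)) fun h1 =>
            hkT (memT.2 ⟨⟨hkr, hpk⟩, h1⟩)
    have h0 := congrArg (fun q => q.coeff H) h
    simp only [twistedOperator_apply, finsetSum_coeff, coeff_zero] at h0
    rw [Finset.sum_congr rfl hcoeff, ← Finset.sum_filter] at h0
    have hTf : (Finset.range (r + 1)).filter (· ∈ T) = T := by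
      ext k
      simp only [Finset.mem_filter, Finset.mem_range]
      exact ⟨fun h => h.2, fun h => ⟨by have := (memT.1 h).1.1; omega, h⟩⟩
    rw [hTf, ← Finset.sum_mul] at h0
    exact (mul_eq_zero.1 h0).resolve_right (leadingCoeff_ne_zero.2 hc)
  have h₁ := memT.1 (T.min'_mem hT)
  have h₂ := memT.1 (T.max'_mem hT)
  set k₁ := T.min' hT with hk₁
  set k₂ := T.max' hT with hk₂
  have vertex : ∀ k ∈ T, (p k).natDegree ∈ (p k).support ∧
      (((p k).natDegree : ℕ) : ℚ) = -(n : ℚ) * (b : ℚ) ^ k + (H : ℚ) := fun k hk =>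
    ⟨natDegree_mem_support_of_nonzero (memT.1 hk).1.2, (onLine _ _).2 (memT.1 hk).2⟩
  refine ⟨k₁, k₂, H, ⟨?_, h₂.1.1, ?_, ?_, ?_, ?_⟩, ?_⟩
  · refine lt_of_le_of_ne (T.min'_le_max' hT) fun h12 => ?_
    have hsing : T = {k₁} := by
      refine Finset.eq_singleton_iff_unique_mem.2 ⟨T.min'_mem hT, fun k hk => ?_⟩
      exact le_antisymm (h12 ▸ T.le_max' k hk) (T.min'_le k hk)
    rw [hsing, Finset.sum_singleton] at sumT
    exact mul_ne_zero (leadingCoeff_ne_zero.2 h₁.1.2) (pow_ne_zero _ hζ) sumT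
  · intro k hk j hj
    have := (point k hk j hj).1
    have h' : ((j + n * b ^ k : ℕ) : ℚ) ≤ (H : ℚ) := Nat.cast_le.2 this
    push_cast at h'
    linarith
  · exact ⟨_, vertex k₁ (T.min'_mem hT)⟩
  · exact ⟨_, vertex k₂ (T.max'_mem hT)⟩
  · intro k hk j hj hjH
    have hkT := ((point k hk j hj).2 ((onLine _ _).1 hjH)).1
    exact ⟨T.min'_le k hkT, T.le_max' k hkT⟩
  · have hinner : ∀ k ∈ Finset.Icc k₁ k₂,
        (∑ j ∈ (p k).support with ((j : ℕ) : ℚ) = -(n : ℚ) * (b : ℚ) ^ k + (H : ℚ),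
          C ((p k).coeff j) * X ^ (k - k₁)) =
        if k ∈ T then C (p k).leadingCoeff * X ^ (k - k₁) else 0 := by
      intro k hk
      have hkr : k ≤ r := (Finset.mem_Icc.1 hk).2.trans h₂.1.1
      split_ifs with hkT
      · rw [Finset.sum_eq_single_of_mem (p k).natDegree
          (Finset.mem_filter.2 (vertex k hkT))]
        · rfl
        · intro j hj hne
          obtain ⟨hj1, hj2⟩ := Finset.mem_filter.1 hj
          exact absurd ((point k hkr j hj1).2 ((onLine _ _).1 hj2)).2 hne
      · refine Finset.sum_eq_zero fun j hj => ?_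
        obtain ⟨hj1, hj2⟩ := Finset.mem_filter.1 hj
        exact absurd ((point k hkr j hj1).2 ((onLine _ _).1 hj2)).1 hkT
    have hTf : (Finset.Icc k₁ k₂).filter (· ∈ T) = T := by
      ext k
      simp only [Finset.mem_filter, Finset.mem_Icc]
      exact ⟨fun h => h.2, fun h => ⟨⟨T.min'_le k h, T.le_max' k h⟩, h⟩⟩
    have hpoly : edgeCharPoly b p k₁ k₂ (-(n : ℚ)) H =
        ∑ k ∈ T, C (p k).leadingCoeff * X ^ (k - k₁) := by
      have hsum : ∑ k ∈ T, C (p k).leadingCoeff * X ^ (k - k₁) =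
          ∑ k ∈ Finset.Icc k₁ k₂, if k ∈ T then C (p k).leadingCoeff * X ^ (k - k₁) else 0 := by
        rw [← Finset.sum_filter, hTf]
      rw [edgeCharPoly, hsum]
      refine Finset.sum_congr rfl fun k hk => ?_
      rw [← hinner k hk]
    rw [hpoly, IsRoot, eval_finsetSum]
    -- Multiplying by `ζ ^ k₁` undoes the shift of exponents in the characteristic polynomial and
    -- gives back `sumT`.
    apply mul_left_cancel₀ (pow_ne_zero k₁ hζ)
    rw [mul_zero, Finset.mul_sum, ← sumT]
    refine Finset.sum_congr rfl fun k hk => ?_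
    rw [eval_mul, eval_C, eval_pow, eval_X, mul_left_comm, ← pow_add,
      Nat.add_sub_cancel' (T.min'_le k hk)]

end Newton

/-! ### The iterations of the main loop -/

section Iteration

variable {K : Type*} [Field K] {E : MahlerEquation K}
variable {L : Type*} [Field L]

theorem exists_formFunction_eq (E : MahlerEquation K) {u : RatFunc L} (hu : u ≠ 0) :
    ∃ (A B c : L[X]) (ζ : L), A.Monic ∧ B.Monic ∧ c ≠ 0 ∧ ζ ≠ 0 ∧
      (mahler L E.b_pos ^ (E.r - 1)) u = formFunction E (RingHom.id L) A B ζ c ∧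
      (∀ i < E.r, IsCoprime (expand L (E.b ^ i) A) B) ∧
      IsCoprime (expand L (E.b ^ (E.r - 1)) A) c ∧ IsCoprime B (expand L E.b c) := by
  have hnum := RatFunc.num_ne_zero hu
  have hζ : u.num.leadingCoeff ≠ 0 := leadingCoeff_ne_zero.2 hnum
  obtain ⟨A, B, c, hA, hB, hc, heq, h1, h2, h3⟩ :=
    exists_gosperPetkovsek (expand L E.b : L[X] →+* L[X]) (fun p hp => hp.expand E.b_pos)
      (E.r - 1) (monic_mul_leadingCoeff_inv hnum) (RatFunc.monic_denom u)
      ((isCoprime_mul_unit_right_left (isUnit_C.2 (inv_ne_zero hζ).isUnit) _ _).2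
        u.isCoprime_num_denom)
  simp only [expandRingHom_pow_apply, RingHom.coe_coe] at heq h1 h2 h3
  refine ⟨A, B, c, u.num.leadingCoeff, hA, hB, hc.ne_zero, hζ, ?_,
    fun i hi => h1 i (by omega), h2, h3⟩
  have hn : u.num = C u.num.leadingCoeff * (u.num * C u.num.leadingCoeff⁻¹) := by
    rw [mul_left_comm, ← C_mul, mul_inv_cancel₀ hζ, C_1, mul_one]
  conv_lhs => rw [← RatFunc.num_div_denom u, hn]
  set a := u.num * C u.num.leadingCoeff⁻¹
  set ζ := u.num.leadingCoeff
  have heq' := congrArg (algebraMap L[X] (RatFunc L)) heq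
  simp only [map_mul] at heq'
  rw [map_div₀, map_mul, map_mul, RatFunc.algebraMap_C, mahler_pow_C, mahler_pow_algebraMap,
    mahler_pow_algebraMap, formFunction, RingHom.id_apply, Polynomial.map_id, Polynomial.map_id]
  have n1 : algebraMap L[X] (RatFunc L) c ≠ 0 := RatFunc.algebraMap_ne_zero hc.ne_zero
  have n2 : algebraMap L[X] (RatFunc L) B ≠ 0 := RatFunc.algebraMap_ne_zero hB.ne_zero
  have n3 : algebraMap L[X] (RatFunc L) (expand L (E.b ^ (E.r - 1)) u.denom) ≠ 0 :=
    RatFunc.algebraMap_ne_zero ((expand_ne_zero (pow_pos E.b_pos _)).2 u.denom_ne_zero)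
  rw [mul_assoc, div_mul_div_comm, mul_div_assoc]
  congr 1
  rw [div_eq_div_iff n3 (mul_ne_zero n1 n2), heq']
  ring

variable [Algebra K L]

theorem Iteration.ext_of_eq {i j : Iteration E L} (hA : i.A = j.A) (hB : i.B = j.B)
    (hζ : i.ζ = j.ζ) : i = j := by
  obtain ⟨A, B, ζ, Δ, _, _, _, _, _, _, h⟩ := i
  obtain ⟨A', B', ζ', Δ', _, _, _, _, _, _, h'⟩ := j
  dsimp only at hA hB hζ
  subst hA hB hζ
  obtain rfl : Δ = Δ' := by exact_mod_cast h.unique h'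
  rfl

variable (E L) in
theorem finite_iteration : Finite (Iteration E L) := by
  let S : Set (L[X] × L[X]) := {A | A.Monic ∧ A ∣ E.coeff L 0} ×ˢ {B | B.Monic ∧ B ∣ E.coeff L E.r}
  have hfin : ∀ f : L[X], f ≠ 0 → {g : L[X] | g.Monic ∧ g ∣ f}.Finite := fun f hf =>
    @Set.toFinite _ _ (@Finite.of_fintype _ (fintypeSubtypeMonicDvd f hf))
  have hS : S.Finite := (hfin _ E.coeff_zero_ne).prod (hfin _ E.coeff_order_ne)
  have hT : (⋃ x ∈ S, (fun ζ : L => (x, ζ)) ''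
      upperRoots E.b E.r (auxCoeff E L x.1 x.2)).Finite :=
    hS.biUnion fun x _ => (finite_upperRoots E.two_le_b).image _
  have := hT.to_subtype
  refine Finite.of_injective (fun i : Iteration E L =>
    (⟨((i.A, i.B), i.ζ), Set.mem_biUnion (x := (i.A, i.B))
      ⟨⟨i.A_monic, i.A_dvd⟩, i.B_monic, i.B_dvd⟩ ⟨i.ζ, i.ζ_mem, rfl⟩⟩ :
      ⋃ x ∈ S, (fun ζ : L => (x, ζ)) '' upperRoots E.b E.r (auxCoeff E L x.1 x.2)))
    fun i j hij => ?_
  simp only [Subtype.mk.injEq, Prod.mk.injEq] at hij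
  exact Iteration.ext_of_eq hij.1.1 hij.1.2 hij.2

theorem Iteration.ζ_ne_zero (i : Iteration E L) : i.ζ ≠ 0 := fun h =>
  zero_notMem_upperRoots (h ▸ i.ζ_mem)

theorem Iteration.mem_solSpace {i : Iteration E L} {c : L[X]} :
    c ∈ i.solSpace ↔ c.degree ≤ (i.Δ : WithBot ℕ) ∧
      twistedOperator E.b E.r (auxCoeff E L i.A i.B) i.ζ c = 0 := by
  rw [Iteration.solSpace, Submodule.mem_inf, mem_degreeLE, LinearMap.mem_ker]

instance Iteration.finite_solSpace (i : Iteration E L) : Module.Finite L i.solSpace := by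
  have h : i.solSpace ≤ degreeLT L (i.Δ + 1) := fun c hc => by
    rw [mem_degreeLT]
    refine (Iteration.mem_solSpace.1 hc).1.trans_lt ?_
    exact_mod_cast Nat.lt_succ_self i.Δ
  have : Module.Finite L (degreeLT L (i.Δ + 1)) :=
    Module.Finite.equiv (degreeLTEquiv L (i.Δ + 1)).symm
  exact Module.Finite.of_injective (Submodule.inclusion h) (Submodule.inclusion_injective h)

/-- All terms with `k ≥ 1` contain the factor `M^(r-1) A`, so it divides the term `k = 0`. There it
is coprime to `c` and to each `M^j B`, the latter by applying `M^j` to the coprimality of `M^(r-1-j)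
A` and `B`. It thus divides `M^(r-1) ℓ 0`, and `M^(r-1)` can be removed. -/
theorem dvd_coeff_zero_of_twistedOperator {A B c : L[X]} {ζ : L}
    (hAB : ∀ i < E.r, IsCoprime (expand L (E.b ^ i) A) B)
    (hAc : IsCoprime (expand L (E.b ^ (E.r - 1)) A) c)
    (h : twistedOperator E.b E.r (auxCoeff E L A B) ζ c = 0) : A ∣ E.coeff L 0 := by
  have hr := E.two_le_r
  rw [← expand_dvd_expand_iff (pow_pos E.b_pos (E.r - 1)).ne']
  rw [twistedOperator_apply, Finset.sum_range_succ'] at h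
  have hdvd : expand L (E.b ^ (E.r - 1)) A ∣ ∑ k ∈ Finset.range E.r,
      auxCoeff E L A B (k + 1) * C (ζ ^ (k + 1)) * expand L (E.b ^ (k + 1)) c := by
    refine Finset.dvd_sum fun k _ => ?_
    rw [auxCoeff]
    refine Dvd.dvd.mul_right (Dvd.dvd.mul_right (Dvd.dvd.mul_right (Dvd.dvd.mul_left ?_ _) _) _) _
    have h1 := Finset.dvd_prod_of_mem (fun j => expand L (E.b ^ (E.r - 1 + j)) A)
      (Finset.mem_range.2 k.succ_pos)
    rwa [add_zero] at h1
  have h0 := (dvd_add_right hdvd).1 (h.symm ▸ dvd_zero _)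
  simp only [auxCoeff, Finset.range_zero, Finset.prod_empty, mul_one, pow_zero, map_one,
    expand_one] at h0
  refine IsCoprime.dvd_of_dvd_mul_right (IsCoprime.prod_right fun j hj => ?_)
    (hAc.dvd_of_dvd_mul_right h0)
  have hj' := (Finset.mem_Ico.1 hj).2
  have h1 := (hAB (E.r - 1 - j) (by omega)).map (expand L (E.b ^ j) : L[X] →+* L[X])
  simp only [RingHom.coe_coe, expand_expand, ← pow_add] at h1
  rwa [show j + (E.r - 1 - j) = E.r - 1 by omega] at h1

/-- The mirror argument: all terms with `k < r` contain `M^(r-1) B`, which is coprime to the other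
factors of the last term. -/
theorem dvd_coeff_order_of_twistedOperator {A B c : L[X]} {ζ : L} (hζ : ζ ≠ 0)
    (hAB : ∀ i < E.r, IsCoprime (expand L (E.b ^ i) A) B) (hBc : IsCoprime B (expand L E.b c))
    (h : twistedOperator E.b E.r (auxCoeff E L A B) ζ c = 0) : B ∣ E.coeff L E.r := by
  have hr := E.two_le_r
  rw [← expand_dvd_expand_iff (pow_pos E.b_pos (E.r - 1)).ne']
  rw [twistedOperator_apply, Finset.sum_range_succ] at h
  have hdvd : expand L (E.b ^ (E.r - 1)) B ∣ ∑ k ∈ Finset.range E.r,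
      auxCoeff E L A B k * C (ζ ^ k) * expand L (E.b ^ k) c := by
    refine Finset.dvd_sum fun k hk => ?_
    have hk' := Finset.mem_range.1 hk
    rw [auxCoeff]
    refine Dvd.dvd.mul_right (Dvd.dvd.mul_right (Dvd.dvd.mul_left ?_ _) _) _
    exact Finset.dvd_prod_of_mem (fun j => expand L (E.b ^ j) B)
      (Finset.mem_Ico.2 ⟨by omega, by omega⟩)
  have h0 := (dvd_add_right hdvd).1 (h.symm ▸ dvd_zero _)
  simp only [auxCoeff, Finset.Ico_self, Finset.prod_empty, mul_one] at h0
  have hmap : ∀ {p q : L[X]}, IsCoprime p q →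
      IsCoprime (expand L (E.b ^ (E.r - 1)) p) (expand L (E.b ^ (E.r - 1)) q) := fun hpq =>
    hpq.map (expand L (E.b ^ (E.r - 1)) : L[X] →+* L[X])
  refine IsCoprime.dvd_of_dvd_mul_right (IsCoprime.prod_right fun j hj => ?_)
    ((isUnit_C.2 (pow_ne_zero _ hζ).isUnit).dvd_mul_right.1
      (IsCoprime.dvd_of_dvd_mul_right ?_ h0))
  · rw [pow_add, ← expand_expand]
    exact hmap (hAB j (Finset.mem_range.1 hj)).symm
  · have h1 := hmap hBc
    rwa [expand_expand, ← pow_succ, Nat.sub_add_cancel (by omega)] at h1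

theorem auxCoeff_zero_ne {A B : L[X]} (hB : B.Monic) : auxCoeff E L A B 0 ≠ 0 := by
  rw [auxCoeff, Finset.range_zero, Finset.prod_empty, mul_one]
  exact mul_ne_zero ((expand_ne_zero (pow_pos E.b_pos _)).2 E.coeff_zero_ne)
    (Finset.prod_ne_zero_iff.2 fun j _ => (expand_ne_zero (pow_pos E.b_pos _)).2 hB.ne_zero)

theorem exists_iteration {u : RatFunc L} (hu : u ∈ E.riccatiSolutions L) :
    ∃ i : Iteration E L, ∃ c ∈ i.solSpace, c ≠ 0 ∧
      (mahler L E.b_pos ^ (E.r - 1)) u = formFunction E (RingHom.id L) i.A i.B i.ζ c := by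
  obtain ⟨A, B, c, ζ, hA, hB, hc, hζ, hform, hAB, hAc, hBc⟩ :=
    exists_formFunction_eq E (ne_zero_of_mem_riccatiSolutions E hu)
  have hker := (mem_riccatiSolutions_iff_twistedOperator E hB hc hform).1 hu
  have hadm : HasAdmissibleEdge E.b E.r (auxCoeff E L A B) ζ (-((c.natDegree : ℤ) : ℚ)) := by
    have := hasAdmissibleEdge_of_twistedOperator_eq_zero E.two_le_b
      ⟨0, Nat.zero_le _, auxCoeff_zero_ne hB⟩ hζ hc hker
    exact_mod_cast this
  -- The opposite slope `deg c` is among the finitely many candidates, so the maximum exists, is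
  -- nonnegative and bounds `deg c`.
  obtain ⟨d, hd, hmax⟩ := Set.exists_max_image _ id
    (finite_admissible_slopes (r := E.r) (p := auxCoeff E L A B) E.two_le_b ζ) ⟨_, hadm⟩
  have hcd : (c.natDegree : ℤ) ≤ d := hmax _ hadm
  obtain ⟨Δ, rfl⟩ := Int.eq_ofNat_of_zero_le ((Int.natCast_nonneg _).trans hcd)
  refine ⟨⟨A, B, ζ, Δ, hA, dvd_coeff_zero_of_twistedOperator hAB hAc hker, hB,
    dvd_coeff_order_of_twistedOperator hζ hAB hBc hker, hAB, ⟨_, hadm⟩, hd, hmax⟩, c, ?_, hc,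
    hform⟩
  refine Iteration.mem_solSpace.2 ⟨?_, hker⟩
  exact natDegree_le_iff_degree_le.1 (by exact_mod_cast hcd)

end Iteration

/-! ### Specialization of parametrized rational functions -/

section Specialization

variable {R : Type*} [CommRing R] [IsDomain R] {L : Type*} [Field L]

theorem map_mahlerIdentity {b : ℕ} (hb : 0 < b) (m : ℕ) (ev : R →+* L) {P Q P' Q' : R[X]}
    (hQ : Q.map ev ≠ 0) (hQ' : Q'.map ev ≠ 0)
    (h : (mahler R hb ^ m) (algebraMap _ _ P / algebraMap _ _ Q) =
      algebraMap _ _ P' / algebraMap _ _ Q') :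
    (mahler L hb ^ m) (algebraMap _ _ (P.map ev) / algebraMap _ _ (Q.map ev)) =
      algebraMap _ _ (P'.map ev) / algebraMap _ _ (Q'.map ev) := by
  have hN : 0 < b ^ m := pow_pos hb m
  have hQ0 : Q ≠ 0 := fun h0 => hQ (by rw [h0, Polynomial.map_zero])
  have hQ0' : Q' ≠ 0 := fun h0 => hQ' (by rw [h0, Polynomial.map_zero])
  rw [map_div₀, mahler_pow_algebraMap, mahler_pow_algebraMap, div_eq_div_iff
    (RatFunc.algebraMap_ne_zero ((expand_ne_zero hN).2 hQ0)) (RatFunc.algebraMap_ne_zero hQ0'),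
    ← map_mul, ← map_mul] at h
  have h' := congrArg (Polynomial.map ev) (RatFunc.algebraMap_injective R h)
  rw [Polynomial.map_mul, Polynomial.map_mul, map_expand, map_expand] at h'
  rw [map_div₀, mahler_pow_algebraMap, mahler_pow_algebraMap, div_eq_div_iff
    (RatFunc.algebraMap_ne_zero ((expand_ne_zero hN).2 hQ)) (RatFunc.algebraMap_ne_zero hQ'),
    ← map_mul, ← map_mul, h']

/-- The denominator of an arbitrary fraction representing `u` may vanish under `ev`. A good one is
extracted from `Q`: `contract` is linear over the image of `expand`, so the cross-multiplied
identity can be contracted, after a shift that keeps a coefficient of `Q` not killed by `ev`. -/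
theorem exists_div_of_mahler_pow_eq {b : ℕ} (hb : 0 < b) (m : ℕ) (ev : R →+* L) {P Q : R[X]}
    (hQ : Q.map ev ≠ 0) {u : RatFunc R}
    (h : (mahler R hb ^ m) u = algebraMap _ _ P / algebraMap _ _ Q) :
    ∃ P' Q' : R[X], Q'.map ev ≠ 0 ∧ u = algebraMap _ _ P' / algebraMap _ _ Q' := by
  have hN : b ^ m ≠ 0 := (pow_pos hb m).ne'
  have hQ0 : Q ≠ 0 := fun h0 => hQ (by rw [h0, Polynomial.map_zero])
  obtain ⟨p, q, hq, rfl⟩ := IsFractionRing.div_surjective R[X] u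
  have hq0 := nonZeroDivisors.ne_zero hq
  rw [map_div₀, mahler_pow_algebraMap, mahler_pow_algebraMap, div_eq_div_iff
    (RatFunc.algebraMap_ne_zero ((expand_ne_zero (pow_pos hb m)).2 hq0))
    (RatFunc.algebraMap_ne_zero hQ0), ← map_mul, ← map_mul] at h
  have h' := RatFunc.algebraMap_injective R h
  obtain ⟨n, hn⟩ : ∃ n, (Q.map ev).coeff n ≠ 0 := by
    by_contra! h0
    exact hQ (Polynomial.ext h0)
  have hle : n ≤ n * b ^ m := Nat.le_mul_of_pos_right n (pow_pos hb m)
  -- The shift moves exponent `n` to `n * b ^ m`, which `contract` sends back to `n`.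
  set e := n * b ^ m - n with he
  have hQ' : (contract (b ^ m) (X ^ e * Q)).map ev ≠ 0 := by
    intro h0
    have h1 := congrArg (fun f => f.coeff n) h0
    simp only [map_contract hN, coeff_contract hN, Polynomial.map_mul, Polynomial.map_pow, map_X,
      coeff_zero] at h1
    rw [coeff_X_pow_mul', if_pos (by omega), show n * b ^ m - e = n by omega] at h1
    exact hn h1
  have hQ0' : contract (b ^ m) (X ^ e * Q) ≠ 0 := fun h0 => hQ' (by rw [h0, Polynomial.map_zero])
  refine ⟨contract (b ^ m) (X ^ e * P), contract (b ^ m) (X ^ e * Q), hQ', ?_⟩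
  rw [div_eq_div_iff (RatFunc.algebraMap_ne_zero hq0) (RatFunc.algebraMap_ne_zero hQ0'),
    ← map_mul, ← map_mul, mul_comm p, ← contract_mul_expand hN, ← contract_mul_expand hN]
  congr 2
  linear_combination X ^ e * h'

end Specialization

/-! ### The parametrizations gathered by the main loop -/

section Generic

variable {L : Type*} [Field L] {s : ℕ}

theorem map_eval_genericSolution (Cs : Fin s → L[X]) (γ : Fin s → L) :
    (genericSolution Cs).map (MvPolynomial.eval γ) = ∑ i, γ i • Cs i := by
  rw [genericSolution, Polynomial.map_sum]
  refine Finset.sum_congr rfl fun i _ => ?_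
  rw [Polynomial.map_mul, map_C, MvPolynomial.eval_X, Polynomial.map_map,
    show (MvPolynomial.eval γ).comp MvPolynomial.C = RingHom.id L from
      RingHom.ext fun x => MvPolynomial.eval_C x, Polynomial.map_id, smul_eq_C_mul]

theorem genericSolution_ne_zero {Cs : Fin s → L[X]} (hs : 0 < s) (h : LinearIndependent L Cs) :
    genericSolution Cs ≠ 0 := by
  intro h0
  have h1 := map_eval_genericSolution Cs (Pi.single ⟨0, hs⟩ 1)
  rw [h0, Polynomial.map_zero, Finset.sum_eq_single ⟨0, hs⟩ (fun i _ hi => by simp [hi])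
    (fun h => absurd (Finset.mem_univ _) h), Pi.single_eq_same, one_smul] at h1
  exact h.ne_zero _ h1.symm

theorem sum_map_genericSolution_eq_zero {b r : ℕ} {p : ℕ → L[X]} {ζ : L} {Cs : Fin s → L[X]}
    (h : ∀ i, twistedOperator b r p ζ (Cs i) = 0) :
    ∑ k ∈ Finset.range (r + 1), (p k).map (MvPolynomial.C (σ := Fin s)) *
      C (MvPolynomial.C ζ ^ k) * expand _ (b ^ k) (genericSolution Cs) = 0 := by
  have h' : ∀ i, C (MvPolynomial.X i) *
      (twistedOperator b r p ζ (Cs i)).map (MvPolynomial.C (σ := Fin s)) = 0 := fun i => by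
    rw [h, Polynomial.map_zero, mul_zero]
  rw [← Finset.sum_eq_zero fun i (_ : i ∈ Finset.univ) => h' i]
  simp only [twistedOperator_apply, genericSolution, map_sum, map_mul, expand_C, Finset.mul_sum,
    Polynomial.map_sum, Polynomial.map_mul, map_C, map_pow, Polynomial.map_pow, map_expand]
  rw [Finset.sum_comm]
  exact Finset.sum_congr rfl fun i _ => Finset.sum_congr rfl fun k _ => by ring

end Generic

section FormFunction

variable {K : Type*} [Field K] (E : MahlerEquation K)
variable {R : Type*} [CommRing R] [IsDomain R] {L : Type*} [Field L]

theorem formFunction_eq_div (φ : L →+* R) (A B : L[X]) (ζ : L) (c : R[X]) :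
    formFunction E φ A B ζ c =
      algebraMap _ _ (C (φ ζ) * expand R E.b c * (expand L (E.b ^ (E.r - 1)) A).map φ) /
        algebraMap _ _ (c * B.map φ) := by
  rw [formFunction, map_mul, map_mul, map_mul, RatFunc.algebraMap_C, mul_div_mul_comm,
    mul_div_assoc]

/-- The factor of `formFunction E (RingHom.id L) A B ζ c` that does not depend on `c`. -/
theorem exists_formFunction_id_eq {A B : L[X]} (hA : A.Monic) (hB : B.Monic) {ζ : L}
    (hζ : ζ ≠ 0) : ∃ g : RatFunc L, g ≠ 0 ∧ ∀ c : L[X],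
      formFunction E (RingHom.id L) A B ζ c =
        g * (mahler L E.b_pos (algebraMap _ _ c) / algebraMap _ _ c) := by
  refine ⟨RatFunc.C ζ * ((mahler L E.b_pos ^ (E.r - 1)) (algebraMap _ _ A) / algebraMap _ _ B),
    ?_, fun c => ?_⟩
  · refine mul_ne_zero ((_root_.map_ne_zero _).2 hζ) (div_ne_zero ((_root_.map_ne_zero _).2 ?_) ?_)
    · exact RatFunc.algebraMap_ne_zero hA.ne_zero
    · exact RatFunc.algebraMap_ne_zero hB.ne_zero
  · rw [formFunction_eq, Polynomial.map_id, Polynomial.map_id, RingHom.id_apply]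
    ring

theorem mahler_div_eq_iff {w w' : RatFunc L} (hw : w ≠ 0) (hw' : w' ≠ 0) :
    mahler L E.b_pos w / w = mahler L E.b_pos w' / w' ↔ ∃ a : L, a ≠ 0 ∧ w' = RatFunc.C a * w := by
  have hMw : mahler L E.b_pos w ≠ 0 := (_root_.map_ne_zero _).2 hw
  constructor
  · intro h
    obtain ⟨a, ha⟩ := exists_eq_C_of_mahler_eq E.two_le_b E.b_pos (q := w' / w) (by
      rw [map_div₀]
      field_simp at h ⊢
      linear_combination -h)
    refine ⟨a, ?_, by rw [← ha]; field_simp⟩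
    rintro rfl
    rw [map_zero, div_eq_zero_iff] at ha
    exact ha.elim hw' hw
  · rintro ⟨a, ha, rfl⟩
    rw [map_mul, mahler_C, mul_div_mul_left _ _ ((_root_.map_ne_zero _).2 ha)]

end FormFunction

/-! ### Evaluation of the parametrizations -/

section Candidates

variable {K : Type*} [Field K] {E : MahlerEquation K}
variable {L : Type*} [Field L] [Algebra K L] {β : BasisChoice E L} {i : Iteration E L}

theorem linearIndependent_basis (β : BasisChoice E L) (i : Iteration E L) :
    LinearIndependent L fun j => (β i j : L[X]) :=
  (β i).linearIndependent.map' i.solSpace.subtype (Submodule.ker_subtype _)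

theorem existsUnique_isIdentified (β : BasisChoice E L) (i : Iteration E L) (hi : 0 < i.dim) :
    ∃! u, IsIdentified β i u := by
  have hker : ∀ j, twistedOperator E.b E.r (auxCoeff E L i.A i.B) i.ζ (β i j) = 0 := fun j =>
    (Iteration.mem_solSpace.1 (β i j).2).2
  obtain ⟨u, hu⟩ := formFunction_mem_fieldRange E (MvPolynomial.C (σ := Fin i.dim)) i.A i.B_monic
    i.ζ (genericSolution_ne_zero hi (linearIndependent_basis β i))
    (sum_map_genericSolution_eq_zero hker)
  have hiff : ∀ v, IsIdentified β i v ↔ (mahler _ E.b_pos ^ (E.r - 1)) v =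
      (mahler _ E.b_pos ^ (E.r - 1)) u := fun v => by
    rw [hu, RingHom.coe_pow]
    rfl
  exact ⟨u, (hiff u).2 rfl, fun v hv =>
    (mahler _ E.b_pos ^ (E.r - 1)).injective ((hiff v).1 hv)⟩

theorem sum_smul_basis_ne_zero (β : BasisChoice E L) (i : Iteration E L) {γ : Fin i.dim → L}
    (hγ : γ ≠ 0) : ∑ j, γ j • (β i j : L[X]) ≠ 0 := fun h =>
  hγ (funext (Fintype.linearIndependent_iff.1 (linearIndependent_basis β i) γ h))

/-- The defining identity of `u` specializes at `γ`, and `M^(r-1)` is injective. So the value is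
unique and does not depend on the fraction chosen to compute it. -/
theorem isValueAt_iff {u : RatFunc (MvPolynomial (Fin i.dim) L)} (hu : IsIdentified β i u)
    {γ : Fin i.dim → L} (hγ : γ ≠ 0) {v : RatFunc L} :
    Param.IsValueAt ⟨i.dim, u⟩ γ v ↔ (mahler L E.b_pos ^ (E.r - 1)) v =
      formFunction E (RingHom.id L) i.A i.B i.ζ (∑ j, γ j • (β i j : L[X])) := by
  set ev : MvPolynomial (Fin i.dim) L →+* L := MvPolynomial.eval γ
  set c := genericSolution fun j => (β i j : L[X])
  have hev : ev.comp MvPolynomial.C = RingHom.id L := RingHom.ext fun x => MvPolynomial.eval_C x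
  have hc : c.map ev = ∑ j, γ j • (β i j : L[X]) := map_eval_genericSolution _ γ
  have hu' : (mahler _ E.b_pos ^ (E.r - 1)) u = formFunction E MvPolynomial.C i.A i.B i.ζ c := by
    rw [RingHom.coe_pow]
    exact hu
  rw [formFunction_eq_div] at hu'
  set P := C (MvPolynomial.C i.ζ) * expand _ E.b c *
    (expand L (E.b ^ (E.r - 1)) i.A).map (MvPolynomial.C (σ := Fin i.dim))
  set Q := c * i.B.map MvPolynomial.C
  have hQ : Q.map ev ≠ 0 := by
    rw [Polynomial.map_mul, Polynomial.map_map, hev, Polynomial.map_id, hc]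
    exact mul_ne_zero (sum_smul_basis_ne_zero β i hγ) i.B_monic.ne_zero
  have hform : formFunction E (RingHom.id L) i.A i.B i.ζ (∑ j, γ j • (β i j : L[X])) =
      algebraMap _ _ (P.map ev) / algebraMap _ _ (Q.map ev) := by
    simp only [P, Q, Polynomial.map_mul, map_C, map_expand, Polynomial.map_map, hev, hc,
      formFunction_eq_div]
    rw [show ev (MvPolynomial.C i.ζ) = i.ζ from MvPolynomial.eval_C _, Polynomial.map_id,
      RingHom.id_apply, Polynomial.map_id]
  rw [hform]
  constructor
  · rintro ⟨P', Q', hQ', hPQ, rfl⟩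
    dsimp only at hPQ
    rw [hPQ] at hu'
    exact map_mahlerIdentity E.b_pos _ ev hQ' hQ hu'
  · intro hv
    obtain ⟨P', Q', hQ', rfl⟩ := exists_div_of_mahler_pow_eq E.b_pos _ ev hQ hu'
    refine ⟨P', Q', hQ', rfl, (mahler L E.b_pos ^ (E.r - 1)).injective ?_⟩
    rw [hv]
    exact (map_mahlerIdentity E.b_pos _ ev hQ' hQ hu').symm

theorem exists_isValueAt {u : RatFunc (MvPolynomial (Fin i.dim) L)} (hu : IsIdentified β i u)
    {γ : Fin i.dim → L} (hγ : γ ≠ 0) : ∃ v, Param.IsValueAt ⟨i.dim, u⟩ γ v := by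
  have hc := sum_smul_basis_ne_zero β i hγ
  have hker : twistedOperator E.b E.r (auxCoeff E L i.A i.B) i.ζ
      (∑ j, γ j • (β i j : L[X])) = 0 :=
    (Iteration.mem_solSpace.1 (sum_mem fun j _ => i.solSpace.smul_mem (γ j) (β i j).2)).2
  obtain ⟨v, hv⟩ := formFunction_mem_fieldRange E (RingHom.id L) i.A i.B_monic i.ζ hc (by
    simpa only [twistedOperator_apply, Polynomial.map_id, RingHom.id_apply] using hker)
  exact ⟨v, (isValueAt_iff hu hγ).2 hv⟩

/-- The rational functions obtained from the nonzero solutions `C` of an iteration. -/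
def Iteration.values (i : Iteration E L) : Set (RatFunc L) :=
  {v | ∃ c ∈ i.solSpace, c ≠ 0 ∧ (mahler L E.b_pos ^ (E.r - 1)) v =
    formFunction E (RingHom.id L) i.A i.B i.ζ c}

theorem image_eq_values {u : RatFunc (MvPolynomial (Fin i.dim) L)} (hu : IsIdentified β i u) :
    Param.image ⟨i.dim, u⟩ = i.values := by
  ext v
  constructor
  · rintro ⟨γ, hγ, hv⟩
    exact ⟨_, sum_mem fun j _ => i.solSpace.smul_mem (γ j) (β i j).2,
      sum_smul_basis_ne_zero β i hγ, (isValueAt_iff hu hγ).1 hv⟩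
  · rintro ⟨c, hc, hc0, hv⟩
    have hsum : ∑ j, (β i).equivFun ⟨c, hc⟩ j • (β i j : L[X]) = c := by
      have h := congrArg i.solSpace.subtype ((β i).sum_equivFun ⟨c, hc⟩)
      simpa only [map_sum, map_smul, Submodule.subtype_apply] using h
    have hγ : (β i).equivFun ⟨c, hc⟩ ≠ 0 := fun h0 => hc0 (by rw [← hsum, h0]; simp)
    exact ⟨_, hγ, (isValueAt_iff hu hγ).2 (by rw [hsum, hv])⟩

theorem formFunction_eq_iff {c c' : L[X]} (hc : c ≠ 0) (hc' : c' ≠ 0) :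
    formFunction E (RingHom.id L) i.A i.B i.ζ c = formFunction E (RingHom.id L) i.A i.B i.ζ c' ↔
      ∃ a : L, a ≠ 0 ∧ c' = a • c := by
  obtain ⟨g, hg, h⟩ := exists_formFunction_id_eq E i.A_monic i.B_monic i.ζ_ne_zero
  rw [h, h, mul_right_inj' hg, mahler_div_eq_iff E (RatFunc.algebraMap_ne_zero hc)
    (RatFunc.algebraMap_ne_zero hc')]
  simp only [← RatFunc.algebraMap_C, ← map_mul, (RatFunc.algebraMap_injective L).eq_iff,
    smul_eq_C_mul]

theorem isBijectiveParametrization {u : RatFunc (MvPolynomial (Fin i.dim) L)} (hi : 0 < i.dim)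
    (hu : IsIdentified β i u) : Param.IsBijectiveParametrization ⟨i.dim, u⟩ := by
  choose f hf using fun x : Projectivization L (Fin i.dim → L) =>
    exists_isValueAt hu x.rep_nonzero
  have hval : ∀ (γ : Fin i.dim → L) (hγ : γ ≠ 0),
      Param.IsValueAt ⟨i.dim, u⟩ γ (f (Projectivization.mk L γ hγ)) := by
    intro γ hγ
    rw [isValueAt_iff hu hγ, (isValueAt_iff hu (Projectivization.rep_nonzero _)).1 (hf _),
      formFunction_eq_iff (sum_smul_basis_ne_zero β i (Projectivization.rep_nonzero _))
        (sum_smul_basis_ne_zero β i hγ)]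
    obtain ⟨a, ha⟩ := Projectivization.exists_smul_eq_mk_rep L γ hγ
    refine ⟨(a⁻¹ : Lˣ), a⁻¹.ne_zero, ?_⟩
    rw [← ha, Finset.smul_sum]
    refine Finset.sum_congr rfl fun j _ => ?_
    rw [smul_smul, Pi.smul_apply, Units.smul_def, smul_eq_mul, ← mul_assoc, Units.inv_mul, one_mul]
  refine ⟨hi, f, hval, fun x _ => ⟨_, x.rep_nonzero, hf x⟩, ?_, ?_⟩
  · intro x _ y _ hxy
    have h1 := (isValueAt_iff hu x.rep_nonzero).1 (hf x)
    have h2 := (isValueAt_iff hu y.rep_nonzero).1 (hf y)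
    rw [← hxy, h1, formFunction_eq_iff (sum_smul_basis_ne_zero β i x.rep_nonzero)
      (sum_smul_basis_ne_zero β i y.rep_nonzero)] at h2
    obtain ⟨a, ha, h⟩ := h2
    have hrep : y.rep = a • x.rep := by
      rw [← sub_eq_zero]
      by_contra hne
      refine sum_smul_basis_ne_zero β i hne ?_
      simp only [Pi.sub_apply, Pi.smul_apply, smul_eq_mul, sub_smul, Finset.sum_sub_distrib,
        mul_smul]
      rw [h, Finset.smul_sum, sub_self]
    rw [← x.mk_rep, ← y.mk_rep, eq_comm, Projectivization.mk_eq_mk_iff']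
    exact ⟨a, hrep.symm⟩
  · rintro v ⟨γ, hγ, hv⟩
    refine ⟨Projectivization.mk L γ hγ, Set.mem_univ _,
      (mahler L E.b_pos ^ (E.r - 1)).injective ?_⟩
    rw [(isValueAt_iff hu hγ).1 hv, (isValueAt_iff hu hγ).1 (hval γ hγ)]

end Candidates

/-! ### Classes of solutions of the Riccati equation -/

section Classes

variable {K : Type*} [Field K] (E : MahlerEquation K)
variable {L : Type*} [Field L] [Algebra K L]

/-- The solutions of the Riccati equation that differ from `u₀` by a factor `M q / q`. -/
def riccatiClass (u₀ : RatFunc L) : Set (RatFunc L) :=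
  {u | u ∈ E.riccatiSolutions L ∧ ∃ q : RatFunc L, q ≠ 0 ∧ u = u₀ * (mahler L E.b_pos q / q)}

theorem mem_riccatiClass_self {u : RatFunc L} (hu : u ∈ E.riccatiSolutions L) :
    u ∈ riccatiClass E u :=
  ⟨hu, 1, one_ne_zero, by simp⟩

theorem riccatiClass_eq_of_mem {u v : RatFunc L} (h : v ∈ riccatiClass E u) :
    riccatiClass E v = riccatiClass E u := by
  obtain ⟨-, q, hq, rfl⟩ := h
  have hMq : mahler L E.b_pos q ≠ 0 := (_root_.map_ne_zero _).2 hq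
  ext w
  constructor
  · rintro ⟨hw, q', hq', rfl⟩
    exact ⟨hw, q * q', mul_ne_zero hq hq', by rw [map_mul, mul_div_mul_comm, mul_assoc]⟩
  · rintro ⟨hw, q', hq', rfl⟩
    refine ⟨hw, q' / q, div_ne_zero hq' hq, ?_⟩
    rw [map_div₀]
    field_simp

theorem values_subset_riccatiSolutions (i : Iteration E L) : i.values ⊆ E.riccatiSolutions L := by
  rintro v ⟨c, hc, hc0, hv⟩
  exact (mem_riccatiSolutions_iff_twistedOperator E i.B_monic hc0 hv).2
    (Iteration.mem_solSpace.1 hc).2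

/-- If `c₀` and `c` give `v₀` and `v`, then `w = c / c₀` satisfies `M w = M^(r-1) (v / v₀) * w`. By
descent `w = M^(r-1) q`, and then `M q = (v / v₀) * q`. -/
theorem values_subset_riccatiClass {i : Iteration E L} {v₀ : RatFunc L} (h₀ : v₀ ∈ i.values) :
    i.values ⊆ riccatiClass E v₀ := by
  intro v hv
  have hvR := values_subset_riccatiSolutions E i hv
  have hv0 := ne_zero_of_mem_riccatiSolutions E (values_subset_riccatiSolutions E i h₀)
  obtain ⟨c₀, -, hc₀, h₀⟩ := h₀
  obtain ⟨c, -, hc, hv⟩ := hv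
  obtain ⟨g, hg, h⟩ := exists_formFunction_id_eq E i.A_monic i.B_monic i.ζ_ne_zero
  rw [h] at h₀ hv
  have n₀ : algebraMap L[X] (RatFunc L) c₀ ≠ 0 := RatFunc.algebraMap_ne_zero hc₀
  have n : algebraMap L[X] (RatFunc L) c ≠ 0 := RatFunc.algebraMap_ne_zero hc
  have m₀ := (_root_.map_ne_zero (mahler L E.b_pos)).2 n₀
  have hw : (algebraMap L[X] (RatFunc L) c / algebraMap _ _ c₀) ≠ 0 := div_ne_zero n n₀
  obtain ⟨q, hq⟩ := mem_fieldRange_of_map_eq_mul (mahler L E.b_pos) (E.r - 1) (g := v / v₀) hw (by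
    rw [map_div₀, map_div₀, h₀, hv]
    field_simp)
  have hq0 : q ≠ 0 := fun h0 => hw (by rw [← hq, h0, map_zero])
  have key : (mahler L E.b_pos ^ (E.r - 1)) (mahler L E.b_pos q) =
      (mahler L E.b_pos ^ (E.r - 1)) (v / v₀ * q) := by
    rw [← RingHom.comp_apply, ← RingHom.mul_def, ← pow_succ, pow_succ_apply, map_mul, hq,
      map_div₀, map_div₀, h₀, hv]
    field_simp
  refine ⟨hvR, q, hq0, ?_⟩
  rw [(mahler L E.b_pos ^ (E.r - 1)).injective key]
  field_simp

/-- The `q ∈ L(x)` such that the product of `q` and a solution `y₀` of `M y₀ = u₀ * y₀` satisfies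
the linear Mahler equation. -/
def gaugeSpace (L : Type*) [Field L] [Algebra K L] (u₀ : RatFunc L) : Submodule L (RatFunc L) where
  carrier := {q | ∑ k ∈ Finset.range (E.r + 1), algebraMap _ _ (E.coeff L k) *
    (∏ j ∈ Finset.range k, (mahler L E.b_pos ^ j) u₀) * (mahler L E.b_pos ^ k) q = 0}
  add_mem' {p q} hp hq := by
    simp only [Set.mem_ofPred_eq, map_add, mul_add, Finset.sum_add_distrib] at hp hq ⊢
    rw [hp, hq, add_zero]
  zero_mem' := by simp
  smul_mem' a q hq := by
    simp only [Set.mem_ofPred_eq, RatFunc.smul_eq_C_mul, map_mul, mahler_pow_C] at hq ⊢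
    rw [Finset.sum_congr rfl fun k _ => mul_left_comm _ (RatFunc.C a) _, ← Finset.mul_sum, hq,
      mul_zero]

theorem mem_gaugeSpace_iff {u₀ q : RatFunc L} (hq : q ≠ 0) :
    q ∈ gaugeSpace E L u₀ ↔ u₀ * (mahler L E.b_pos q / q) ∈ E.riccatiSolutions L := by
  have hprod : ∀ k, ∏ j ∈ Finset.range k, (mahler L E.b_pos ^ j) (u₀ * (mahler L E.b_pos q / q)) =
      (∏ j ∈ Finset.range k, (mahler L E.b_pos ^ j) u₀) * (mahler L E.b_pos ^ k) q / q := by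
    intro k
    induction k with
    | zero => simp [hq]
    | succ k ih =>
      have hk : (mahler L E.b_pos ^ k) q ≠ 0 := (_root_.map_ne_zero _).2 hq
      have e : (mahler L E.b_pos ^ k) (mahler L E.b_pos q) = (mahler L E.b_pos ^ (k + 1)) q := by
        rw [pow_add_apply, pow_one]
      rw [Finset.prod_range_succ, ih, Finset.prod_range_succ, map_mul, map_div₀, e]
      field_simp
  rw [mem_riccatiSolutions_iff]
  simp only [hprod]
  have hsum : ∑ k ∈ Finset.range (E.r + 1), algebraMap _ _ (E.coeff L k) *
      ((∏ j ∈ Finset.range k, (mahler L E.b_pos ^ j) u₀) * (mahler L E.b_pos ^ k) q / q) =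
      (∑ k ∈ Finset.range (E.r + 1), algebraMap _ _ (E.coeff L k) *
        (∏ j ∈ Finset.range k, (mahler L E.b_pos ^ j) u₀) * (mahler L E.b_pos ^ k) q) / q := by
    rw [Finset.sum_div]
    exact Finset.sum_congr rfl fun k _ => by simp only [mul_assoc, mul_div_assoc]
  rw [hsum, div_eq_zero_iff, or_iff_left hq]
  rfl

/-- The function attached to `q` comes from `c` exactly when `M^(r-1) q / c` solves a first-order
equation that is independent of `q` and `c`. Its nonzero solutions are the constant multiples of one
of them, `w`, so the condition becomes `M^(r-1) q ∈ w * i.solSpace`, which is linear in `q`. -/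
theorem exists_submodule_values {u₀ : RatFunc L} (hu₀ : u₀ ≠ 0) (i : Iteration E L) :
    ∃ W : Submodule L (RatFunc L), ∀ q : RatFunc L, q ≠ 0 →
      (q ∈ W ↔ u₀ * (mahler L E.b_pos q / q) ∈ i.values) := by
  by_cases hex : ∃ q : RatFunc L, q ≠ 0 ∧ u₀ * (mahler L E.b_pos q / q) ∈ i.values
  swap
  -- If no `q` qualifies, the zero subspace works, as only nonzero `q` are tested.
  · exact ⟨⊥, fun q hq => ⟨fun h => absurd h hq, fun h => absurd ⟨q, hq, h⟩ hex⟩⟩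
  obtain ⟨q₁, hq₁, c₁, -, hc₁, h₁⟩ := hex
  obtain ⟨g, hg, hform⟩ := exists_formFunction_id_eq E i.A_monic i.B_monic i.ζ_ne_zero
  have hpow : ∀ q : RatFunc L, (mahler L E.b_pos ^ (E.r - 1)) (mahler L E.b_pos q) =
      mahler L E.b_pos ((mahler L E.b_pos ^ (E.r - 1)) q) := fun q => by
    rw [← RingHom.comp_apply, ← RingHom.mul_def, ← pow_succ, pow_succ_apply]
  set Mm := mahler L E.b_pos ^ (E.r - 1) with hMm
  have hU : Mm u₀ ≠ 0 := (_root_.map_ne_zero _).2 hu₀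
  have rel : ∀ {q : RatFunc L} {c : L[X]}, q ≠ 0 → c ≠ 0 →
      (Mm (u₀ * (mahler L E.b_pos q / q)) =
        formFunction E (RingHom.id L) i.A i.B i.ζ c ↔
      mahler L E.b_pos (Mm q / algebraMap _ _ c) / (Mm q / algebraMap _ _ c) = g / Mm u₀) := by
    intro q c hq hc
    have n1 : Mm q ≠ 0 := (_root_.map_ne_zero _).2 hq
    have n2 : algebraMap L[X] (RatFunc L) c ≠ 0 := RatFunc.algebraMap_ne_zero hc
    have n3 := (_root_.map_ne_zero (mahler L E.b_pos)).2 n2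
    rw [hform, map_mul, map_div₀, map_div₀, hpow]
    field_simp
  set w := Mm q₁ / algebraMap _ _ c₁ with hw
  have hw0 : w ≠ 0 :=
    div_ne_zero ((_root_.map_ne_zero _).2 hq₁) (RatFunc.algebraMap_ne_zero hc₁)
  have hw1 := (rel hq₁ hc₁).1 h₁
  refine ⟨{ carrier := {q | ∃ c ∈ i.solSpace, Mm q = w * algebraMap _ _ c}
            add_mem' := ?_, zero_mem' := ⟨0, zero_mem _, by simp⟩, smul_mem' := ?_ }, ?_⟩
  · rintro p q ⟨c, hc, hp⟩ ⟨d, hd, hq⟩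
    exact ⟨c + d, add_mem hc hd, by rw [map_add, map_add, hp, hq, mul_add]⟩
  · rintro a q ⟨c, hc, hq⟩
    exact ⟨a • c, i.solSpace.smul_mem a hc, by
      rw [RatFunc.smul_eq_C_mul, map_mul, hMm, mahler_pow_C, ← hMm, hq, smul_eq_C_mul, map_mul,
        RatFunc.algebraMap_C]
      ring⟩
  · intro q hq
    constructor
    · rintro ⟨c, hc, h⟩
      have hMq : Mm q ≠ 0 := (_root_.map_ne_zero _).2 hq
      have hc0 : c ≠ 0 := by
        rintro rfl
        exact hMq (by rw [h, map_zero, mul_zero])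
      refine ⟨c, hc, hc0, (rel hq hc0).2 ?_⟩
      rw [h, mul_div_cancel_right₀ _ (RatFunc.algebraMap_ne_zero hc0), hw1]
    · rintro ⟨c, hc, hc0, h⟩
      have hMq : Mm q ≠ 0 := (_root_.map_ne_zero _).2 hq
      have n2 : algebraMap L[X] (RatFunc L) c ≠ 0 := RatFunc.algebraMap_ne_zero hc0
      obtain ⟨a, -, ha⟩ := (mahler_div_eq_iff E hw0 (div_ne_zero hMq n2)).1
        (hw1.trans ((rel hq hc0).1 h).symm)
      refine ⟨a • c, i.solSpace.smul_mem a hc, ?_⟩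
      rw [smul_eq_C_mul, map_mul, RatFunc.algebraMap_C, (div_eq_iff n2).1 ha]
      ring

theorem exists_values_eq_riccatiClass [CharZero K] {u₀ : RatFunc L}
    (hu₀ : u₀ ∈ E.riccatiSolutions L) : ∃ i : Iteration E L, i.values = riccatiClass E u₀ := by
  have : CharZero L := charZero_of_injective_algebraMap (algebraMap K L).injective
  have := finite_iteration E L
  choose W hW using exists_submodule_values E (ne_zero_of_mem_riccatiSolutions E hu₀) (L := L)
  have hmem : ∀ q : RatFunc L, q ≠ 0 → q ∈ gaugeSpace E L u₀ → ∃ i, q ∈ W i := by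
    intro q hq hqV
    obtain ⟨i, hi⟩ := exists_iteration ((mem_gaugeSpace_iff E hq).1 hqV)
    exact ⟨i, (hW i q hq).2 hi⟩
  have h1 : (1 : RatFunc L) ∈ gaugeSpace E L u₀ :=
    (mem_gaugeSpace_iff E (one_ne_zero (α := RatFunc L))).2 (by simpa using hu₀)
  -- A vector space over an infinite field is not a finite union of proper subspaces; this is where
  -- characteristic `0` enters.
  obtain ⟨i, hi⟩ := Subspace.exists_eq_top_of_iUnion_eq_univ
    (p := fun i => (W i).comap (gaugeSpace E L u₀).subtype) (by
      refine Set.eq_univ_of_forall fun q => Set.mem_iUnion.2 ?_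
      by_cases hq : (q : RatFunc L) = 0
      · obtain ⟨i, -⟩ := hmem 1 one_ne_zero h1
        exact ⟨i, by simp [hq]⟩
      · exact hmem q hq q.2)
  have hi' : gaugeSpace E L u₀ ≤ W i := Submodule.comap_subtype_eq_top.1 hi
  have hsub : riccatiClass E u₀ ⊆ i.values := by
    rintro u ⟨hu, q, hq, rfl⟩
    exact (hW i q hq).1 (hi' ((mem_gaugeSpace_iff E hq).2 hu))
  exact ⟨i, (values_subset_riccatiClass E (hsub (mem_riccatiClass_self E hu₀))).antisymm hsub⟩

end Classes

/-! ### First-order Mahler equations over Puiseux series -/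

section Puiseux

variable (L : Type*) [Field L]

/-- This solves `M g = g w` coefficient by coefficient. For `n > 0` the equation determines `g n`
from earlier coefficients, because `n / b < n`; for `n = 0` it holds trivially, which leaves `g 0 =
1` free to be imposed. -/
theorem exists_powerSeries_mahler {b : ℕ} (hb : 2 ≤ b) (w : PowerSeries L)
    (hw : PowerSeries.coeff 0 w = 1) :
    ∃ g : PowerSeries L, PowerSeries.coeff 0 g = 1 ∧
      ∀ n, PowerSeries.coeff n (g * w) = if b ∣ n then PowerSeries.coeff (n / b) g else 0 := by
  classical
  let F : ∀ n : ℕ, (∀ k, k < n → L) → L := fun n h =>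
    if hn : n = 0 then 1 else
      (if b ∣ n then h (n / b) (Nat.div_lt_self (Nat.pos_of_ne_zero hn) hb) else 0) -
        ∑ j : Fin n, h j j.2 * PowerSeries.coeff (n - j) w
  let g : ℕ → L := Nat.lt_wfRel.wf.fix F
  have hg : ∀ n, g n = F n fun k _ => g k := fun n => Nat.lt_wfRel.wf.fix_eq F n
  have hg0 : g 0 = 1 := by rw [hg]; simp [F]
  refine ⟨PowerSeries.mk g, by rw [PowerSeries.coeff_mk, hg0], fun n => ?_⟩
  rw [PowerSeries.coeff_mul, Finset.Nat.sum_antidiagonal_eq_sum_range_succ_mk,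
    Finset.sum_range_succ]
  simp only [PowerSeries.coeff_mk, Nat.sub_self, hw, mul_one]
  rcases eq_or_ne n 0 with rfl | hn
  · simp
  · rw [hg n]
    simp only [F, dif_neg hn]
    rw [← Fin.sum_univ_eq_sum_range (fun k => g k * PowerSeries.coeff (n - k) w) n,
      add_sub_cancel]

theorem ramify_single {q : ℕ} (hq : 0 < q) (n : ℤ) (a : L) :
    ramify L hq (HahnSeries.single n a) = HahnSeries.single ((n : ℚ) / q) a :=
  HahnSeries.embDomain_single

theorem mahlerHahn_single {b : ℕ} (hb : 0 < b) (x : ℚ) (a : L) :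
    mahlerHahn L hb (HahnSeries.single x a) = HahnSeries.single (b * x) a :=
  HahnSeries.embDomain_single

theorem ramify_ofPowerSeries (f : PowerSeries L) :
    ramify L Nat.one_pos (HahnSeries.ofPowerSeries ℤ L f) = HahnSeries.ofPowerSeries ℚ L f := by
  rw [HahnSeries.ofPowerSeries_apply, HahnSeries.ofPowerSeries_apply]
  refine embDomain_embDomain (fun n => ?_) _
  change (((n : ℤ) : ℚ)) / ((1 : ℕ) : ℚ) = (n : ℚ)
  simp

theorem mahlerHahn_ofPowerSeries {b : ℕ} (hb : 0 < b) {f g : PowerSeries L}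
    (h : ∀ n, PowerSeries.coeff n f = if b ∣ n then PowerSeries.coeff (n / b) g else 0) :
    mahlerHahn L hb (HahnSeries.ofPowerSeries ℚ L g) = HahnSeries.ofPowerSeries ℚ L f := by
  let e : ℕ ↪o ℕ := OrderEmbedding.ofMapLEIff (fun n => b * n) fun m n => by
    simp only [mul_le_mul_iff_right₀ hb]
  let e' : ℕ ↪o ℚ := OrderEmbedding.ofMapLEIff (fun n => (b : ℚ) * n) fun m n => by
    rw [mul_le_mul_iff_right₀ (by exact_mod_cast hb), Nat.cast_le]
  have hf : HahnSeries.toPowerSeries.symm f =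
      HahnSeries.embDomain e (HahnSeries.toPowerSeries.symm g) := by
    ext n
    rw [HahnSeries.coeff_toPowerSeries_symm, h]
    split_ifs with hn
    · obtain ⟨k, rfl⟩ := hn
      rw [Nat.mul_div_cancel_left _ hb, show b * k = e k from rfl, HahnSeries.embDomain_coeff,
        HahnSeries.coeff_toPowerSeries_symm]
    · rw [HahnSeries.embDomain_of_notMem_range]
      rintro ⟨k, rfl⟩
      exact hn ⟨k, rfl⟩
  rw [HahnSeries.ofPowerSeries_apply, HahnSeries.ofPowerSeries_apply, hf]
  refine (embDomain_embDomain (h := e') (fun n => rfl) _).trans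
    (embDomain_embDomain (h := e') (fun n => ?_) _).symm
  change (((b * n : ℕ)) : ℚ) = (b : ℚ) * n
  push_cast
  rfl

theorem ratToPuiseux_algebraMap (p : L[X]) :
    ((ratToPuiseux L (algebraMap _ _ p) : Puiseux L) : HahnSeries ℚ L) =
      HahnSeries.ofPowerSeries ℚ L p := by
  change ramify L Nat.one_pos (ratToLaurent L (algebraMap _ _ p)) = _
  rw [ratToLaurent, IsFractionRing.lift_algebraMap, Polynomial.algebraMap_hahnSeries_apply,
    ramify_ofPowerSeries]

theorem constPuiseux_coe (a : L) :
    ((constPuiseux L a : Puiseux L) : HahnSeries ℚ L) = HahnSeries.C a := by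
  rw [constPuiseux, RingHom.comp_apply, ← RatFunc.algebraMap_C, ratToPuiseux_algebraMap,
    Polynomial.coe_C, HahnSeries.ofPowerSeries_C]

theorem mahlerPuiseux_ratToPuiseux {b : ℕ} (hb : 0 < b) (u : RatFunc L) :
    mahlerPuiseux L hb (ratToPuiseux L u) = ratToPuiseux L (mahler L hb u) := by
  have hpoly : ∀ p : L[X], mahlerPuiseux L hb (ratToPuiseux L (algebraMap _ _ p)) =
      ratToPuiseux L (mahler L hb (algebraMap _ _ p)) := by
    intro p
    rw [mahler_algebraMap]
    apply Subtype.ext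
    change mahlerHahn L hb ((ratToPuiseux L (algebraMap _ _ p) : Puiseux L) : HahnSeries ℚ L) = _
    rw [ratToPuiseux_algebraMap, ratToPuiseux_algebraMap]
    refine mahlerHahn_ofPowerSeries L hb fun n => ?_
    rw [Polynomial.coeff_coe, coeff_expand hb, Polynomial.coeff_coe]
  rw [← RatFunc.num_div_denom u]
  simp only [map_div₀, hpoly]

/-- Write `u = a x^ν w` with `w(0) = 1`. The constant `a` is absorbed by `e_a`, the power `x^ν` by
`x^(ν/(b-1))`, since `M` multiplies exponents by `b`, and `w` by the power series solution of `M g =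
g w`. -/
theorem exists_puiseux_solution {b : ℕ} (hb : 2 ≤ b) (hb₀ : 0 < b) {u : RatFunc L} (hu : u ≠ 0) :
    ∃ (a : Lˣ) (f : Puiseux L), f ≠ 0 ∧
      constPuiseux L (a : L) * mahlerPuiseux L hb₀ f = ratToPuiseux L u * f := by
  set U := ratToLaurent L u with hU
  have hU0 : U ≠ 0 := (_root_.map_ne_zero _).2 hu
  set a := PowerSeries.coeff 0 U.powerSeriesPart with ha
  have ha0 : a ≠ 0 := by
    rw [ha, LaurentSeries.powerSeriesPart_coeff, Nat.cast_zero, add_zero]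
    exact HahnSeries.coeff_order_eq_zero.not.2 hU0
  set w := PowerSeries.C a⁻¹ * U.powerSeriesPart with hw
  obtain ⟨g, hg0, hg⟩ := exists_powerSeries_mahler L hb w (by
    rw [hw, PowerSeries.coeff_C_mul, ← ha, inv_mul_cancel₀ ha0])
  have hb1 : 0 < b - 1 := by omega
  have hb1' : ((b - 1 : ℕ) : ℚ) ≠ 0 := by exact_mod_cast hb1.ne'
  set v : ℚ := (U.order : ℚ) / (b - 1 : ℕ) with hv
  set f : HahnSeries ℚ L := HahnSeries.single v 1 * HahnSeries.ofPowerSeries ℚ L g with hf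
  have hfmem : f ∈ puiseux L :=
    mul_mem ⟨b - 1, hb1, HahnSeries.single U.order 1, ramify_single L hb1 _ _⟩
      ⟨1, Nat.one_pos, HahnSeries.ofPowerSeries ℤ L g, ramify_ofPowerSeries L g⟩
  have hf0 : f ≠ 0 := by
    refine mul_ne_zero (HahnSeries.single_ne_zero one_ne_zero) fun h0 => ?_
    rw [map_eq_zero_iff _ HahnSeries.ofPowerSeries_injective] at h0
    rw [h0, map_zero] at hg0
    exact zero_ne_one hg0
  have hUpp : U.powerSeriesPart = PowerSeries.C a * w := by
    rw [hw, ← mul_assoc, ← map_mul, mul_inv_cancel₀ ha0, map_one, one_mul]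
  have hUr : ((ratToPuiseux L u : Puiseux L) : HahnSeries ℚ L) =
      HahnSeries.single (U.order : ℚ) 1 * (HahnSeries.C a * HahnSeries.ofPowerSeries ℚ L w) := by
    change ramify L Nat.one_pos U = _
    conv_lhs => rw [← LaurentSeries.single_order_mul_powerSeriesPart U, hUpp]
    rw [map_mul, ramify_single, Nat.cast_one, div_one]
    congr 1
    exact (ramify_ofPowerSeries L _).trans (by rw [map_mul, HahnSeries.ofPowerSeries_C])
  refine ⟨Units.mk0 a ha0, ⟨f, hfmem⟩, fun h0 => hf0 (congrArg Subtype.val h0), Subtype.ext ?_⟩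
  change ((constPuiseux L a : Puiseux L) : HahnSeries ℚ L) * mahlerHahn L hb₀ f =
    ((ratToPuiseux L u : Puiseux L) : HahnSeries ℚ L) * f
  rw [constPuiseux_coe, hUr, hf, map_mul, mahlerHahn_single, mahlerHahn_ofPowerSeries L hb₀ hg,
    map_mul]
  have hbv : (b : ℚ) * v = U.order + v := by
    rw [hv, Nat.cast_sub (by omega)]
    rw [Nat.cast_sub (by omega)] at hb1'
    push_cast at hb1' ⊢
    field_simp
    ring
  have hsingle : (HahnSeries.single ((b : ℚ) * v) (1 : L)) =
      HahnSeries.single (U.order : ℚ) 1 * HahnSeries.single v 1 := by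
    rw [HahnSeries.single_mul_single, hbv, mul_one]
  rw [hsingle]
  ring

end Puiseux

/-! ### Hypergeometric solutions and blocks -/

section Blocks

variable {L : Type*} [Field L] {b : ℕ} (hb : 0 < b)

theorem mahlerGenSeries_single (a : Lˣ) (f : Puiseux L) :
    mahlerGenSeries L hb (MonoidAlgebra.single a f) =
      MonoidAlgebra.single a (constPuiseux L (a : L) * mahlerPuiseux L hb f) := by
  refine (MonoidAlgebra.liftNCRingHom_single _ _ _ a f).trans ?_
  change MonoidAlgebra.single 1 (mahlerPuiseux L hb f) *
    MonoidAlgebra.single a (constPuiseux L (a : L)) = _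
  rw [MonoidAlgebra.single_mul_single, one_mul, mul_comm]

theorem mahlerGenSeries_ratToGenSeries (u : RatFunc L) :
    mahlerGenSeries L hb (ratToGenSeries L u) = ratToGenSeries L (mahler L hb u) := by
  change mahlerGenSeries L hb (MonoidAlgebra.single 1 (ratToPuiseux L u)) =
    MonoidAlgebra.single 1 (ratToPuiseux L (mahler L hb u))
  rw [mahlerGenSeries_single, Units.val_one, map_one, one_mul, mahlerPuiseux_ratToPuiseux]

theorem ratToGenSeries_mul_eq_zero {u : RatFunc L} {y : GenSeries L} (hy : y ≠ 0) :
    ratToGenSeries L u * y = 0 ↔ u = 0 := by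
  refine ⟨fun h => ?_, fun h => by rw [h, map_zero, zero_mul]⟩
  by_contra hu
  apply hy
  rw [← one_mul y, ← map_one (ratToGenSeries L), ← inv_mul_cancel₀ hu, map_mul, mul_assoc, h,
    mul_zero]

variable {K : Type*} [Field K] (E : MahlerEquation K)

theorem HasQuotient.iterate {u : RatFunc L} {y : GenSeries L} (h : HasQuotient E u y) (k : ℕ) :
    (mahlerGenSeries L E.b_pos)^[k] y =
      ratToGenSeries L (∏ j ∈ Finset.range k, (mahler L E.b_pos ^ j) u) * y := by
  induction k with
  | zero => simp
  | succ k ih =>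
    rw [Function.iterate_succ_apply', ih, map_mul, mahlerGenSeries_ratToGenSeries, h,
      Finset.prod_range_succ', map_prod, ← mul_assoc, ← map_mul]
    simp only [pow_succ_apply, pow_zero, RingHom.coe_one, id]

theorem HasQuotient.unique {u u' : RatFunc L} {y : GenSeries L} (hy : y ≠ 0)
    (h : HasQuotient E u y) (h' : HasQuotient E u' y) : u = u' := by
  rw [← sub_eq_zero, ← ratToGenSeries_mul_eq_zero hy, map_sub, sub_mul, ← h, ← h', sub_self]

theorem HasQuotient.ratToGenSeries_mul {u q : RatFunc L} {y : GenSeries L} (hq : q ≠ 0)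
    (h : HasQuotient E u y) :
    HasQuotient E (u * (mahler L E.b_pos q / q)) (ratToGenSeries L q * y) := by
  rw [HasQuotient, map_mul, mahlerGenSeries_ratToGenSeries, h, ← mul_assoc, ← mul_assoc,
    ← map_mul, ← map_mul]
  congr 2
  field_simp

theorem exists_hasQuotient {u : RatFunc L} (hu : u ≠ 0) :
    ∃ y : GenSeries L, y ≠ 0 ∧ HasQuotient E u y := by
  obtain ⟨a, f, hf, h⟩ := exists_puiseux_solution L E.two_le_b E.b_pos hu
  refine ⟨MonoidAlgebra.single a f, fun h0 => hf (MonoidAlgebra.single_eq_zero.1 h0), ?_⟩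
  rw [HasQuotient, mahlerGenSeries_single, h]
  change _ = MonoidAlgebra.single 1 (ratToPuiseux L u) * MonoidAlgebra.single a f
  rw [MonoidAlgebra.single_mul_single, one_mul]

variable [Algebra K L]

theorem HasQuotient.isLinearSolution_iff {u : RatFunc L} {y : GenSeries L} (hy : y ≠ 0)
    (h : HasQuotient E u y) : IsLinearSolution E y ↔ u ∈ E.riccatiSolutions L := by
  rw [mem_riccatiSolutions_iff, ← ratToGenSeries_mul_eq_zero hy, map_sum, Finset.sum_mul,
    IsLinearSolution]
  simp only [h.iterate, map_mul, mul_assoc]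

/-- Multiplying `y₀` by `q` multiplies its quotient by `M q / q`. Being a linear solution depends
only on the quotient, through the Riccati equation. -/
theorem block_eq_riccatiClass {u₀ : RatFunc L} {y₀ : GenSeries L} (hy₀ : y₀ ≠ 0)
    (h₀ : HasQuotient E u₀ y₀) :
    {u | ∃ y ∈ hypergeometricSolutions L E, Similar y y₀ ∧ HasQuotient E u y} =
      riccatiClass E u₀ := by
  ext u
  constructor
  · rintro ⟨y, ⟨hy, hlin, -⟩, ⟨q, hq, rfl⟩, hu⟩
    exact ⟨(hu.isLinearSolution_iff E hy).1 hlin, q, hq,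
      hu.unique E hy (h₀.ratToGenSeries_mul E hq)⟩
  · rintro ⟨hu, q, hq, rfl⟩
    have hy : ratToGenSeries L q * y₀ ≠ 0 := fun h => hq ((ratToGenSeries_mul_eq_zero hy₀).1 h)
    have hquot := h₀.ratToGenSeries_mul E hq
    exact ⟨_, ⟨hy, (hquot.isLinearSolution_iff E hy).2 hu, _, hquot⟩, ⟨q, hq, rfl⟩, hquot⟩

variable (L) in
theorem blocks_eq : blocks L E = riccatiClass E '' E.riccatiSolutions L := by
  ext 𝔅
  constructor
  · rintro ⟨y₀, ⟨hy₀, hlin, u₀, h₀⟩, rfl⟩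
    exact ⟨u₀, (h₀.isLinearSolution_iff E hy₀).1 hlin, (block_eq_riccatiClass E hy₀ h₀).symm⟩
  · rintro ⟨u₀, hu₀, rfl⟩
    obtain ⟨y₀, hy₀, h₀⟩ := exists_hasQuotient E (ne_zero_of_mem_riccatiSolutions E hu₀)
    exact ⟨y₀, ⟨hy₀, (h₀.isLinearSolution_iff E hy₀).2 hu₀, u₀, h₀⟩,
      (block_eq_riccatiClass E hy₀ h₀).symm⟩

end Blocks

/-! ### The cleaning loop -/

section Cleaning

variable {L : Type*} [Field L]

theorem CleaningStep.ssubset {𝒰 𝒰' : Set (Param L)} (h : CleaningStep 𝒰 𝒰') : 𝒰' ⊂ 𝒰 := by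
  obtain ⟨p, hp, -, -, -, -, rfl⟩ := h
  exact ⟨Set.sdiff_subset, fun h => (h hp).2 rfl⟩

theorem acc_cleaningStep {𝒰 : Set (Param L)} (h : 𝒰.Finite) :
    Acc (fun 𝒰' 𝒰 : Set (Param L) => CleaningStep 𝒰 𝒰') 𝒰 := by
  induction hn : 𝒰.ncard using Nat.strong_induction_on generalizing 𝒰 with
  | _ n ih =>
    subst hn
    exact ⟨_, fun 𝒱 h𝒱 => ih _ (Set.ncard_lt_ncard h𝒱.ssubset h) (h.subset h𝒱.ssubset.subset) rfl⟩

theorem exists_terminal_of_acc {𝒰 : Set (Param L)}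
    (h : Acc (fun 𝒰' 𝒰 : Set (Param L) => CleaningStep 𝒰 𝒰') 𝒰) :
    ∃ 𝒱, Relation.ReflTransGen CleaningStep 𝒰 𝒱 ∧ ¬ ∃ 𝒱', CleaningStep 𝒱 𝒱' := by
  induction h with
  | intro 𝒰 _ ih =>
    by_cases hex : ∃ 𝒱', CleaningStep 𝒰 𝒱'
    · obtain ⟨𝒱', h𝒱'⟩ := hex
      obtain ⟨𝒱, h1, h2⟩ := ih 𝒱' h𝒱'
      exact ⟨𝒱, h1.head h𝒱', h2⟩
    · exact ⟨𝒰, .refl, hex⟩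

end Cleaning

/-! ### Termination and the possible outputs -/

section Output

variable {K : Type*} [Field K] {E : MahlerEquation K}
variable {L : Type*} [Field L] [Algebra K L]

theorem finite_candidates (β : BasisChoice E L) : (candidates β).Finite := by
  have := finite_iteration E L
  choose u hu huniq using existsUnique_isIdentified β
  refine (Set.finite_range fun i : {i : Iteration E L // 0 < i.dim} =>
    (⟨i.1.dim, u i.1 i.2⟩ : Param L)).subset ?_
  rintro _ ⟨i, v, hi, hv, rfl⟩
  exact ⟨⟨i, hi⟩, by rw [huniq i hi v hv]⟩

variable (E L) in
theorem terminates : Terminates E L :=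
  ⟨finite_iteration E L, fun i => i.finite_solSpace,
    ⟨fun i => Module.finBasis L i.solSpace⟩, existsUnique_isIdentified,
    fun β => acc_cleaningStep (finite_candidates β)⟩

theorem image_subset_riccatiClass {β : BasisChoice E L} {p : Param L} (hp : p ∈ candidates β) :
    ∃ v ∈ E.riccatiSolutions L, p.image ⊆ riccatiClass E v := by
  obtain ⟨i, u, hi, hu, rfl⟩ := hp
  have hγ : (fun _ => 1 : Fin i.dim → L) ≠ 0 := fun h =>
    one_ne_zero (congrFun h ⟨0, hi⟩)
  obtain ⟨v, hv⟩ := exists_isValueAt hu hγ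
  have hv' : v ∈ i.values := by
    rw [← image_eq_values hu]
    exact ⟨_, hγ, hv⟩
  exact ⟨v, values_subset_riccatiSolutions E i hv',
    image_eq_values hu ▸ values_subset_riccatiClass E hv'⟩

theorem exists_candidate_image_eq [CharZero K] (β : BasisChoice E L) {u₀ : RatFunc L}
    (hu₀ : u₀ ∈ E.riccatiSolutions L) : ∃ p ∈ candidates β, p.image = riccatiClass E u₀ := by
  obtain ⟨i, hi⟩ := exists_values_eq_riccatiClass E hu₀
  have hmem : u₀ ∈ i.values := hi ▸ mem_riccatiClass_self E hu₀
  obtain ⟨c, hc, hc0, -⟩ := hmem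
  have hdim : 0 < i.dim := by
    have : Nontrivial i.solSpace := ⟨⟨⟨c, hc⟩, 0, fun h => hc0 (congrArg Subtype.val h)⟩⟩
    exact Module.finrank_pos
  obtain ⟨u, hu, -⟩ := existsUnique_isIdentified β i hdim
  exact ⟨_, ⟨i, u, hdim, hu, rfl⟩, (image_eq_values hu).trans hi⟩

/-- If the removed `p` parametrizes a whole class, then so does the `q` that justifies the removal:
its image contains that class and lies in a single class. -/
theorem cleaning_invariant [CharZero K] {β : BasisChoice E L} {𝒰 : Set (Param L)}
    (h : Relation.ReflTransGen CleaningStep (candidates β) 𝒰) :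
    𝒰 ⊆ candidates β ∧ ∀ u ∈ E.riccatiSolutions L, ∃ p ∈ 𝒰, p.image = riccatiClass E u := by
  induction h with
  | refl => exact ⟨subset_rfl, fun u hu => exists_candidate_image_eq β hu⟩
  | tail _ hstep ih =>
    obtain ⟨hsub, hcover⟩ := ih
    refine ⟨hstep.ssubset.subset.trans hsub, fun u hu => ?_⟩
    obtain ⟨p, hp, q, hq, hpq, himage, rfl⟩ := hstep
    obtain ⟨p', hp', hp'u⟩ := hcover u hu
    by_cases hpp : p' = p
    · subst hpp
      refine ⟨q, ⟨hq, fun h => hpq h.symm⟩, ?_⟩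
      obtain ⟨v, hv, hqv⟩ := image_subset_riccatiClass (hsub hq)
      rw [hp'u] at himage
      have huv := riccatiClass_eq_of_mem E (hqv (himage (mem_riccatiClass_self E hu)))
      exact (huv ▸ hqv).antisymm himage
    · exact ⟨p', ⟨hp', hpp⟩, hp'u⟩

theorem output_properties [CharZero K] {𝒰 : Set (Param L)} (h : IsOutput E L 𝒰) :
    𝒰.Finite ∧
      (∀ p ∈ 𝒰, p.IsBijectiveParametrization) ∧
      𝒰.PairwiseDisjoint Param.image ∧
      (⋃ p ∈ 𝒰, p.image) = E.riccatiSolutions L ∧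
      Set.BijOn Param.image 𝒰 (blocks L E) := by
  obtain ⟨β, hβ, hterm⟩ := h
  obtain ⟨hsub, hcover⟩ := cleaning_invariant hβ
  -- No cleaning step remains, so inclusion of images forces equality of elements. This yields
  -- injectivity, and in `hclass` it identifies each element with the one covering its whole class.
  have hmax : ∀ p ∈ 𝒰, ∀ q ∈ 𝒰, p.image ⊆ q.image → p = q := fun p hp q hq hpq => by
    by_contra hne
    exact hterm ⟨_, p, hp, q, hq, hne, hpq, rfl⟩
  have hclass : ∀ p ∈ 𝒰, ∃ v ∈ E.riccatiSolutions L, p.image = riccatiClass E v := by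
    intro p hp
    obtain ⟨v, hv, hpv⟩ := image_subset_riccatiClass (hsub hp)
    obtain ⟨q, hq, hqv⟩ := hcover v hv
    exact ⟨v, hv, hmax p hp q hq (hqv ▸ hpv) ▸ hqv⟩
  refine ⟨(finite_candidates β).subset hsub, fun p hp => ?_, fun p hp q hq hpq => ?_,
    Set.Subset.antisymm ?_ ?_, fun p hp => ?_, fun p hp q hq hpq => hmax p hp q hq hpq.subset, ?_⟩
  · obtain ⟨i, u, hi, hu, rfl⟩ := hsub hp
    exact isBijectiveParametrization hi hu
  · obtain ⟨v, -, hv⟩ := hclass p hp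
    obtain ⟨w, -, hw⟩ := hclass q hq
    refine Set.disjoint_left.2 fun u hu hu' => hpq (hmax p hp q hq ?_)
    rw [hv] at hu ⊢
    rw [hw] at hu' ⊢
    rw [← riccatiClass_eq_of_mem E hu, riccatiClass_eq_of_mem E hu']
  · refine Set.iUnion₂_subset fun p hp => ?_
    obtain ⟨v, -, hv⟩ := hclass p hp
    exact hv ▸ fun u hu => hu.1
  · intro u hu
    obtain ⟨p, hp, hpu⟩ := hcover u hu
    exact Set.mem_biUnion hp (hpu ▸ mem_riccatiClass_self E hu)
  · obtain ⟨v, hv, hpv⟩ := hclass p hp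
    exact blocks_eq L E ▸ ⟨v, hv, hpv.symm⟩
  · rw [blocks_eq]
    rintro _ ⟨u, hu, rfl⟩
    exact hcover u hu

end Output

end MahlerBP

end

theorem mainTheorem2 {K : Type*} [Field K] [CharZero K] (L : Type*) [Field L] [Algebra K L]
    [Algebra.IsAlgebraic K L] (E : MahlerBP.MahlerEquation K) :
    MahlerBP.Terminates E L ∧
    (∃ 𝒰 : Set (MahlerBP.Param L), MahlerBP.IsOutput E L 𝒰) ∧
    ∀ 𝒰 : Set (MahlerBP.Param L), MahlerBP.IsOutput E L 𝒰 →
      𝒰.Finite ∧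
      (∀ p ∈ 𝒰, p.IsBijectiveParametrization) ∧
      𝒰.PairwiseDisjoint MahlerBP.Param.image ∧
      (⋃ p ∈ 𝒰, p.image) = E.riccatiSolutions L ∧
      Set.BijOn MahlerBP.Param.image 𝒰 (MahlerBP.blocks L E) := by
  have hterm := MahlerBP.terminates E L
  obtain ⟨β⟩ := hterm.2.2.1
  obtain ⟨𝒰, h𝒰⟩ := MahlerBP.exists_terminal_of_acc (hterm.2.2.2.2 β)
  exact ⟨hterm, ⟨𝒰, β, h𝒰⟩, fun _ => MahlerBP.output_properties⟩
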